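/- Let $P$ be a general logic program, i.e. a finite list of clauses $A\leftarrow L_1,\dots,L_n$ with $A$ an atom and each $L_i$ a literal (an atom or a negated atom), and let $Q_0=p({\cal I}_1,\dots,{\cal I}_m,T_1,\dots,T_n)$ be a moded query, where the ${\cal I}_i$ are input modes (placeholders for arbitrary ground terms, in any argument positions) and the $T_j$ are terms. *Generalized SLDNF-trees.* For a top goal $G_0=\leftarrow A$, the generalized SLDNF-tree $GT_{G_0}$ has root $N_0:G_0$ and always selects the left-most subgoal. A node with a selected positive subgoal has a child for every clause whose head (standardized apart) unifies with it, namely the resolvent under an idempotent most general unifier, in which a goal variable is never replaced by a clause variable. A node with a selected ground subgoal $\neg A$ is connected by a negation arc to the root $\leftarrow A$ of a subsidiary SLDNF-tree for $A$; moreover, if the SLDNF-tree for $A$ is finitely failed, the node has a child obtained by deleting $\neg A$, and if that tree has a success leaf, the node is a failure leaf. Clauses are tried depth-first in textual order, and a subsidiary tree stops at its first success leaf, i.e. nothing to the right of a success leaf is expanded. A body literal introduced by resolving a selected subgoal $L$ has as ancestors $L$ and all ancestors of $L$; the other subgoals keep their ancestors; the subgoal $A$ at the end of a negation arc inherits the ancestors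 of $\neg A$. A derivation is a path of $GT_{G_0}$, possibly through negation arcs, that starts at the root. *Moded queries.* The moded-query forest $MF_{Q_0}$ consists of the trees $GT_{\leftarrow p(t_1,\dots,t_m,T_1,\dots,T_n)}$ for all $t_1,\dots,t_m$ in the Herbrand universe of $P\cup\{\leftarrow Q_0\}$ (the ground terms built from the constants and function symbols that occur in $P$ or $Q_0$, with an arbitrary constant added if there is none). $P$ *terminates* for $Q_0$ if $MF_{Q_0}$ has no infinite derivation. The moded generalized SLDNF-tree $MT_{Q_0}$ is $GT_{\leftarrow p(I_1,\dots,I_m,T_1,\dots,T_n)}$ for distinct variables $I_1,\dots,I_m$ that do not occur in any $T_j$; these are *input variables*, an input variable is never substituted by a variable that is not an input variable, and whenever an input variable is substituted by a term, all variables of that term become input variables. *Loop goals.* The symbol string of an atom is the sequence of its predicate symbol, function symbols, constants and variables read from left to right, with every variable replaced by one symbol $\mathcal X$. For nodes $N_i:G_i$ and $N_j:G_j$ of a derivation, $G_j$ is a *loop goal* of $G_i$ if the selected subgoals of $G_i$ and $G_j$ are positive and have the same predicate symbol, the former is an ancestor of the latter, and the symbol string of the former is obtained from that of the latter by removing zero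 or more elements. Assume that $Q_0$ is non-floundering: no negative subgoal containing a variable (ordinary or input) is selected at any node of $MT_{Q_0}$. Then $P$ terminates for $Q_0$ if and only if $MT_{Q_0}$ has no infinite derivation $D$ of the form $$N_0:G_0\Rightarrow\cdots N_{g_1}:G_{g_1}\Rightarrow\cdots N_{g_2}:G_{g_2}\Rightarrow\cdots N_{g_3}:G_{g_3}\Rightarrow\cdots$$ such that (i) for every $j\ge 1$, $G_{g_{j+1}}$ is a loop goal of $G_{g_j}$; and (ii) for no input variable $I$ does $D$ contain an infinite chain of substitutions $I/f_1(\dots,Y_1,\dots),\ \dots,\ Y_1/f_2(\dots,Y_2,\dots),\ \dots,\ Y_{i-1}/f_i(\dots,Y_i,\dots),\ \dots$ (made at successively later steps of $D$). -/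

import Mathlib

universe u v

namespace LP

/-! Terms are the first-order terms `L.Term ℕ` over a language `L`, with `ℕ` as the countably
infinite supply of variables. A constant is a function symbol of arity `0`. -/

/-- Substitutions. -/
abbrev Subst (L : FirstOrder.Language.{u, v}) := ℕ → L.Term ℕ

/-- The identity substitution. -/
def idSubst (L : FirstOrder.Language.{u, v}) : Subst L := fun x => FirstOrder.Language.Term.var x

/-- The variables that occur in a term. -/
def termVars {L : FirstOrder.Language.{u, v}} (t : L.Term ℕ) : Set ℕ := ↑t.varFinset

/-- The function symbols and constants that occur in a term. -/
def termFuncs {L : FirstOrder.Language.{u, v}} : L.Term ℕ → Set (Σ n, L.Functions n)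
  | .var _ => ∅
  | .func f ts => insert ⟨_, f⟩ (⋃ i, termFuncs (ts i))

/-- An atom `p(T₁, ..., Tₙ)`. -/
structure Atom (L : FirstOrder.Language.{u, v}) where
  arity : ℕ
  pred : L.Relations arity
  args : Fin arity → L.Term ℕ

namespace Atom

variable {L : FirstOrder.Language.{u, v}}

/-- The predicate symbol (together with its arity). -/
def predSymbol (A : Atom L) : Σ n, L.Relations n := ⟨A.arity, A.pred⟩

def subst (A : Atom L) (θ : Subst L) : Atom L := ⟨A.arity, A.pred, fun i => (A.args i).subst θ⟩

def vars (A : Atom L) : Set ℕ := ⋃ i, termVars (A.args i)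

def funcs (A : Atom L) : Set (Σ n, L.Functions n) := ⋃ i, termFuncs (A.args i)

def Ground (A : Atom L) : Prop := A.vars = ∅

end Atom

/-- A literal is an atom or the negation of an atom. -/
inductive Literal (L : FirstOrder.Language.{u, v}) where
  | pos (A : Atom L) : Literal L
  | neg (A : Atom L) : Literal L

namespace Literal

variable {L : FirstOrder.Language.{u, v}}

def atom : Literal L → Atom L
  | pos A => A
  | neg A => A

def subst (θ : Subst L) : Literal L → Literal L
  | pos A => pos (A.subst θ)
  | neg A => neg (A.subst θ)

end Literal

/-- The variables that occur in a list of literals. -/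
def litVars {L : FirstOrder.Language.{u, v}} (G : List (Literal L)) : Set ℕ := {x | ∃ l ∈ G, x ∈ l.atom.vars}

/-- A program clause `head ← body`. -/
structure Clause (L : FirstOrder.Language.{u, v}) where
  head : Atom L
  body : List (Literal L)

namespace Clause

variable {L : FirstOrder.Language.{u, v}}

def subst (C : Clause L) (θ : Subst L) : Clause L := ⟨C.head.subst θ, C.body.map (Literal.subst θ)⟩

def vars (C : Clause L) : Set ℕ := C.head.vars ∪ litVars C.body

def funcs (C : Clause L) : Set (Σ n, L.Functions n) := C.head.funcs ∪ {f | ∃ l ∈ C.body, f ∈ l.atom.funcs}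

end Clause

/-- A general logic program: finitely many clauses, in the textual order in which the depth-first
strategy tries them. -/
abbrev Program (L : FirstOrder.Language.{u, v}) := List (Clause L)

/-- The function symbols and constants that occur in a program. -/
def Program.funcs {L : FirstOrder.Language.{u, v}} (P : Program L) : Set (Σ n, L.Functions n) :=
  {f | ∃ C ∈ P, f ∈ C.funcs}

/-- The Herbrand universe over a set `S` of function symbols: the ground terms built from `S`,
where the constant `a` is added when `S` contains no constant. -/
def herbrandUniverse {L : FirstOrder.Language.{u, v}} (a : L.Constants) (S : Set (Σ n, L.Functions n)) :
    Set (L.Term ℕ) :=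
  {t | termVars t = ∅ ∧
    ∀ f ∈ termFuncs t, f ∈ S ∨ ((∀ c : L.Constants, ⟨0, c⟩ ∉ S) ∧ f = ⟨0, a⟩)}

/-! ### Resolution -/

/-- `C'` is a variant of the clause `C` that is standardized apart from the variables in `used`, and
`θ` is an idempotent, relevant most general unifier of the atom `A` and the head of `C'`, oriented
by the two conventions on pairs of variables: a variable of `A` is never replaced by a clause
variable, and an input variable is never replaced by a variable that is not an input variable.
The clause `most_general` says that every unifier `σ` factors as `σ = σ ∘ θ`, which is the notion of
an idempotent most general unifier. -/
structure Resolves {L : FirstOrder.Language.{u, v}} (inputs used : Set ℕ) (A : Atom L) (C C' : Clause L)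
    (θ : Subst L) : Prop where
  variant : ∃ e : Equiv.Perm ℕ, C' = C.subst (fun x => FirstOrder.Language.Term.var (e x))
  fresh : Disjoint C'.vars used
  unifies : A.subst θ = C'.head.subst θ
  most_general : ∀ σ : Subst L, A.subst σ = C'.head.subst σ → ∀ x, (θ x).subst σ = σ x
  relevant : ∀ x, θ x ≠ FirstOrder.Language.Term.var x →
    x ∈ A.vars ∪ C'.head.vars ∧ termVars (θ x) ⊆ A.vars ∪ C'.head.vars
  goal_var : ∀ x ∈ A.vars, ∀ y, θ x = FirstOrder.Language.Term.var y → y ∈ A.vars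
  input_var : ∀ x ∈ inputs, ∀ y, θ x = FirstOrder.Language.Term.var y → y ∈ inputs

/-- The resolvent of the goal `← A, rest` with the clause variant `C'` under `θ`. -/
def resolvent {L : FirstOrder.Language.{u, v}} (C' : Clause L) (rest : List (Literal L)) (θ : Subst L) :
    List (Literal L) :=
  (C'.body ++ rest).map (Literal.subst θ)

/-- The outcome of SLDNF-resolution with the left-most selection rule: `Outcome P true G` says that
the SLDNF-tree for `P ∪ {← G}` has a success leaf, and `Outcome P false G` says that it is finitely
failed (it is finite and all its leaves are failure leaves). A selected ground literal `¬A` is a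
failure leaf if the subsidiary tree for `← A` has a success leaf, and it is removed if that
subsidiary tree is finitely failed. A selected non-ground negative literal has neither outcome. -/
inductive Outcome {L : FirstOrder.Language.{u, v}} (P : Program L) : Bool → List (Literal L) → Prop where
  | success_nil : Outcome P true []
  | success_pos (A : Atom L) (rest : List (Literal L)) (C C' : Clause L) (θ : Subst L) :
      C ∈ P → Resolves ∅ (litVars (Literal.pos A :: rest)) A C C' θ →
      Outcome P true (resolvent C' rest θ) →
      Outcome P true (Literal.pos A :: rest)
  | success_neg (A : Atom L) (rest : List (Literal L)) :
      A.Ground → Outcome P false [Literal.pos A] → Outcome P true rest →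
      Outcome P true (Literal.neg A :: rest)
  | failure_pos (A : Atom L) (rest : List (Literal L)) :
      (∀ (C C' : Clause L) (θ : Subst L), C ∈ P →
        Resolves ∅ (litVars (Literal.pos A :: rest)) A C C' θ →
        Outcome P false (resolvent C' rest θ)) →
      Outcome P false (Literal.pos A :: rest)
  | failure_neg_leaf (A : Atom L) (rest : List (Literal L)) :
      A.Ground → Outcome P true [Literal.pos A] →
      Outcome P false (Literal.neg A :: rest)
  | failure_neg (A : Atom L) (rest : List (Literal L)) :
      A.Ground → Outcome P false [Literal.pos A] → Outcome P false rest →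
      Outcome P false (Literal.neg A :: rest)

/-! ### Generalized SLDNF-trees -/

/-- A subgoal at a node: a literal with its ancestors. The ancestors are selected subgoals of
earlier nodes on the path from the root, and each of them is given by the depth of its node. -/
structure Subgoal (L : FirstOrder.Language.{u, v}) where
  lit : Literal L
  anc : Set ℕ

/-- A node of a generalized SLDNF-tree: its depth (the number of edges from the root), its goal,
the variables used so far on the path from the root, the current input variables, and whether the
node lies in a subsidiary SLDNF-tree (one that is entered by a negation arc). -/
structure Node (L : FirstOrder.Language.{u, v}) where
  depth : ℕ
  goal : List (Subgoal L)
  used : Set ℕ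
  inputs : Set ℕ
  subsidiary : Prop

/-- The edges `N ⇒_θ N'` of a generalized SLDNF-tree; the left-most subgoal is selected.
There is an edge for every admissible choice of the clause variant and of the mgu; different choices
only affect the names of variables. -/
inductive Step {L : FirstOrder.Language.{u, v}} (P : Program L) : Node L → Subst L → Node L → Prop where
  /-- Resolution of a positive subgoal with the clause number `k`. A subsidiary tree stops at its
  first success leaf: no child is generated to the right of a subtree with a success leaf. The body
  literals get the selected subgoal as a new ancestor, and the variables of the terms that are
  substituted for input variables become input variables. -/
  | resolve (n : ℕ) (A : Atom L) (anc : Set ℕ) (rest : List (Subgoal L)) (used inputs : Set ℕ)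
      (sub : Prop) (k : ℕ) (C C' : Clause L) (θ : Subst L) :
      P[k]? = some C → Resolves inputs used A C C' θ →
      (sub → ∀ j < k, ∀ (E E' : Clause L) (η : Subst L), P[j]? = some E →
        Resolves ∅ (litVars (Literal.pos A :: rest.map Subgoal.lit)) A E E' η →
        ¬ Outcome P true (resolvent E' (rest.map Subgoal.lit) η)) →
      Step P ⟨n, ⟨Literal.pos A, anc⟩ :: rest, used, inputs, sub⟩ θ
        ⟨n + 1,
          C'.body.map (fun l => ⟨l.subst θ, insert n anc⟩) ++
            rest.map (fun s => ⟨s.lit.subst θ, s.anc⟩),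
          used ∪ C'.vars,
          ⋃ x ∈ inputs, termVars (θ x),
          sub⟩
  /-- The negation arc from a ground subgoal `¬A` to the root `← A` of its subsidiary tree; `A`
  inherits the ancestors of `¬A`. -/
  | negArc (n : ℕ) (A : Atom L) (anc : Set ℕ) (rest : List (Subgoal L)) (used inputs : Set ℕ)
      (sub : Prop) :
      A.Ground →
      Step P ⟨n, ⟨Literal.neg A, anc⟩ :: rest, used, inputs, sub⟩ (idSubst L)
        ⟨n + 1, [⟨Literal.pos A, anc⟩], used, inputs, True⟩
  /-- The child of a node with selected ground subgoal `¬A` whose subsidiary tree is finitely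
  failed. -/
  | negSuccess (n : ℕ) (A : Atom L) (anc : Set ℕ) (rest : List (Subgoal L)) (used inputs : Set ℕ)
      (sub : Prop) :
      A.Ground → Outcome P false [Literal.pos A] →
      Step P ⟨n, ⟨Literal.neg A, anc⟩ :: rest, used, inputs, sub⟩ (idSubst L)
        ⟨n + 1, rest, used, inputs, sub⟩

/-- The root `← Q` of the generalized SLDNF-tree for the top goal `← Q`, where the variables
in `inputs` are treated as input variables. -/
def rootNode {L : FirstOrder.Language.{u, v}} (Q : Atom L) (inputs : Set ℕ) : Node L :=
  ⟨0, [⟨Literal.pos Q, ∅⟩], Q.vars ∪ inputs, inputs, False⟩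

/-- `N` is a node of the generalized SLDNF-tree with the given root. -/
def InTree {L : FirstOrder.Language.{u, v}} (P : Program L) (root N : Node L) : Prop :=
  Relation.ReflTransGen (fun M M' => ∃ θ, Step P M θ M') root N

/-- No negative subgoal that contains a variable (ordinary or input) is selected at any node of the
generalized SLDNF-tree with the given root. -/
def NonFloundering {L : FirstOrder.Language.{u, v}} (P : Program L) (root : Node L) : Prop :=
  ∀ N, InTree P root N → ∀ (A : Atom L) (anc : Set ℕ) (rest : List (Subgoal L)),
    N.goal = ⟨Literal.neg A, anc⟩ :: rest → A.Ground

/-- An infinite derivation: an infinite path of the generalized SLDNF-tree that starts at its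
root, with the substitution of each step. -/
structure InfDerivation {L : FirstOrder.Language.{u, v}} (P : Program L) (root : Node L) where
  node : ℕ → Node L
  mgu : ℕ → Subst L
  node_zero : node 0 = root
  step : ∀ i, Step P (node i) (mgu i) (node (i + 1))

/-! ### Loop goals -/

/-- The symbols of a symbol string; `X` stands for every variable. -/
inductive Sym (L : FirstOrder.Language.{u, v}) where
  | pred (p : Σ n, L.Relations n) : Sym L
  | func (f : Σ n, L.Functions n) : Sym L
  | X : Sym L

/-- The symbol string of a term. -/
def termString {L : FirstOrder.Language.{u, v}} : L.Term ℕ → List (Sym L)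
  | .var _ => [Sym.X]
  | .func f ts => Sym.func ⟨_, f⟩ :: (List.ofFn fun i => termString (ts i)).flatten

/-- The symbol string of an atom. -/
def Atom.string {L : FirstOrder.Language.{u, v}} (A : Atom L) : List (Sym L) :=
  Sym.pred A.predSymbol :: (List.ofFn fun i => termString (A.args i)).flatten

/-- `A` loops into `B`: they have the same predicate symbol, and the symbol string of `A` is obtained
from that of `B` by removing zero or more elements. -/
def LoopsInto {L : FirstOrder.Language.{u, v}} (A B : Atom L) : Prop :=
  A.predSymbol = B.predSymbol ∧ List.Sublist A.string B.string

/-- The goal at `N'` is a loop goal of the goal at `N` (for two nodes of one derivation): the selected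
subgoals are positive, the one at `N` is an ancestor of the one at `N'`, and it loops into it. -/
def LoopGoal {L : FirstOrder.Language.{u, v}} (N N' : Node L) : Prop :=
  ∃ (A B : Atom L) (α β : Set ℕ) (r s : List (Subgoal L)),
    N.goal = ⟨Literal.pos A, α⟩ :: r ∧ N'.goal = ⟨Literal.pos B, β⟩ :: s ∧
    N.depth ∈ β ∧ LoopsInto A B

namespace InfDerivation

variable {L : FirstOrder.Language.{u, v}} {P : Program L} {root : Node L}

/-- There are nodes `N_{g 0}, N_{g 1}, ...` of the derivation, further and further down, each of which
carries a loop goal of the one before. -/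
def HasLoopForm (D : InfDerivation P root) : Prop :=
  ∃ g : ℕ → ℕ, StrictMono g ∧ ∀ j, LoopGoal (D.node (g j)) (D.node (g (j + 1)))

/-- For some input variable `I = Y 0` the derivation contains an infinite chain of substitutions
`I / f₁(..., Y 1, ...), Y 1 / f₂(..., Y 2, ...), ...`. -/
def HasInfiniteInputChain (D : InfDerivation P root) : Prop :=
  ∃ k Y : ℕ → ℕ, StrictMono k ∧ Y 0 ∈ (D.node (k 0)).inputs ∧
    ∀ i, ∃ (n : ℕ) (f : L.Functions n) (ts : Fin n → L.Term ℕ),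
      D.mgu (k i) (Y i) = FirstOrder.Language.Term.func f ts ∧
      Y (i + 1) ∈ termVars (FirstOrder.Language.Term.func f ts)

end InfDerivation

/-! ### Moded queries -/

/-- A moded query: an atom some of whose arguments are input modes (`none`), the others being
terms. (A query without input modes is a concrete query.) -/
structure ModedQuery (L : FirstOrder.Language.{u, v}) where
  arity : ℕ
  pred : L.Relations arity
  args : Fin arity → Option (L.Term ℕ)

namespace ModedQuery

variable {L : FirstOrder.Language.{u, v}}

/-- The function symbols and constants that occur in the query. -/
def funcs (Q : ModedQuery L) : Set (Σ n, L.Functions n) :=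
  {f | ∃ i T, Q.args i = some T ∧ f ∈ termFuncs T}

/-- The atom obtained from the query by putting `t i` for the input mode in position `i`. -/
def inst (Q : ModedQuery L) (t : Fin Q.arity → L.Term ℕ) : Atom L :=
  ⟨Q.arity, Q.pred, fun i => (Q.args i).getD (t i)⟩

/-- `I` assigns to the input modes distinct variables that do not occur in the terms of the query. -/
def IsInputVars (Q : ModedQuery L) (I : Fin Q.arity → ℕ) : Prop :=
  (∀ i j, Q.args i = none → Q.args j = none → I i = I j → i = j) ∧
  ∀ i j T, Q.args i = none → Q.args j = some T → I i ∉ termVars T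

/-- The root of the moded generalized SLDNF-tree, with the input variables `I`. -/
def modedRoot (Q : ModedQuery L) (I : Fin Q.arity → ℕ) : Node L :=
  rootNode (Q.inst fun i => FirstOrder.Language.Term.var (I i)) {x | ∃ i, Q.args i = none ∧ x = I i}

/-- The roots of the trees of the moded-query forest: every input mode is replaced by a ground term
of the Herbrand universe (of the program and the query), and there are no input variables. -/
def forestRoots (P : Program L) (a : L.Constants) (Q : ModedQuery L) : Set (Node L) :=
  {N | ∃ t : Fin Q.arity → L.Term ℕ,
    (∀ i, Q.args i = none → t i ∈ herbrandUniverse a (P.funcs ∪ Q.funcs)) ∧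
    N = rootNode (Q.inst t) ∅}

end ModedQuery

/-- `P` terminates for `Q`: the moded-query forest of `P` for `Q` has no infinite derivation. -/
def Terminates {L : FirstOrder.Language.{u, v}} (P : Program L) (a : L.Constants) (Q : ModedQuery L) : Prop :=
  ∀ N ∈ Q.forestRoots P a, IsEmpty (InfDerivation P N)

end LP

/-! Every infinite derivation of the moded tree contains an infinite sequence of loop goals, so the
substance is this: the forest has an infinite derivation exactly when the moded tree has one without
an infinite chain of input substitutions.

From the forest to the moded tree, a derivation is lifted step by step (`Lifts.exists_step`),
together with a substitution that is ground on the input variables. Non-floundering makes selected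
negative subgoals ground, hence identical on both levels. Subsidiary trees stop at their first
success, a condition on outcomes of goals; inside them the lifted goal is a variant of the given
one, and `Outcome.of_isVariant` transfers the condition. Along a chain of input substitutions the
ground terms represented by the variables shrink strictly, so no chain is infinite.

Loop goals come from `InfDerivation.hasLoopForm`. A goal is a stack; if its height at a node is
never undercut later, the subgoal selected there is an ancestor of the one selected at any later
node of the same kind with a positive selection. Only finitely many symbols occur, so Higman's lemma
extracts a subsequence of atoms each of which embeds into the next.

From the moded tree to the forest, an input variable is replaced at most once and by a term with
finitely many variables. Without an infinite chain, only finitely many input variables ever arise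
and their substitutions stop (`InfDerivation.eventually_inputs`). The surviving ones are set to a
fixed Herbrand term, the values are propagated backwards (`InfDerivation.exists_limit`), and every
step survives this instantiation (`Step.instantiate`). -/

namespace LP

open FirstOrder.Language (Term)

variable {L : FirstOrder.Language.{u, v}}

/-! ### Substitution, variables, symbols and size of terms -/

section Terms

@[simp] theorem termVars_var (x : ℕ) : termVars (Term.var x : L.Term ℕ) = {x} := by
  simp [termVars]

@[simp] theorem termVars_func {n : ℕ} (f : L.Functions n) (ts : Fin n → L.Term ℕ) :
    termVars (Term.func f ts) = ⋃ i, termVars (ts i) := by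
  ext x; simp [termVars]

theorem finite_termVars (t : L.Term ℕ) : (termVars t).Finite := Finset.finite_toSet _

@[simp] theorem subst_var (x : ℕ) (σ : Subst L) : (Term.var x : L.Term ℕ).subst σ = σ x := rfl

@[simp] theorem subst_func {n : ℕ} (f : L.Functions n) (ts : Fin n → L.Term ℕ) (σ : Subst L) :
    (Term.func f ts).subst σ = Term.func f fun i => (ts i).subst σ := rfl

@[simp] theorem termFuncs_var (x : ℕ) : termFuncs (Term.var x : L.Term ℕ) = ∅ := rfl

@[simp] theorem termFuncs_func {n : ℕ} (f : L.Functions n) (ts : Fin n → L.Term ℕ) :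
    termFuncs (Term.func f ts) = insert ⟨_, f⟩ (⋃ i, termFuncs (ts i)) := rfl

theorem subst_subst (t : L.Term ℕ) (σ τ : Subst L) :
    (t.subst σ).subst τ = t.subst fun x => (σ x).subst τ := by
  induction t with
  | var x => rfl
  | func f ts ih => simp [ih]

theorem subst_congr_iff {t : L.Term ℕ} {σ τ : Subst L} :
    t.subst σ = t.subst τ ↔ ∀ x ∈ termVars t, σ x = τ x := by
  induction t with
  | var x => simp
  | func f ts ih =>
    simp only [subst_func, Term.func.injEq, heq_eq_eq, true_and, termVars_func, Set.mem_iUnion,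
      funext_iff, ih]
    exact ⟨fun h x ⟨i, hi⟩ => h i x hi, fun h i x hi => h x ⟨i, hi⟩⟩

theorem subst_congr {t : L.Term ℕ} {σ τ : Subst L} (h : ∀ x ∈ termVars t, σ x = τ x) :
    t.subst σ = t.subst τ := subst_congr_iff.2 h

@[simp] theorem subst_id (t : L.Term ℕ) : t.subst (fun x => Term.var x) = t := by
  induction t with
  | var x => rfl
  | func f ts ih => simp [ih]

theorem subst_eq_self_iff {t : L.Term ℕ} {σ : Subst L} :
    t.subst σ = t ↔ ∀ x ∈ termVars t, σ x = Term.var x := by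
  conv_lhs => rhs; rw [← subst_id t]
  exact subst_congr_iff

theorem subst_eq_self {t : L.Term ℕ} {σ : Subst L} (h : ∀ x ∈ termVars t, σ x = Term.var x) :
    t.subst σ = t := subst_eq_self_iff.2 h

theorem subst_of_ground {t : L.Term ℕ} (h : termVars t = ∅) (σ : Subst L) : t.subst σ = t :=
  subst_eq_self (by simp [h])

theorem mem_termVars_subst {t : L.Term ℕ} {σ : Subst L} {y : ℕ} :
    y ∈ termVars (t.subst σ) ↔ ∃ x ∈ termVars t, y ∈ termVars (σ x) := by
  induction t with
  | var x => simp
  | func f ts ih =>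
    simp only [subst_func, termVars_func, Set.mem_iUnion, ih]
    exact ⟨fun ⟨i, x, h, h'⟩ => ⟨x, ⟨i, h⟩, h'⟩, fun ⟨x, ⟨i, h⟩, h'⟩ => ⟨i, x, h, h'⟩⟩

theorem ground_subst_iff {t : L.Term ℕ} {σ : Subst L} :
    termVars (t.subst σ) = ∅ ↔ ∀ x ∈ termVars t, termVars (σ x) = ∅ := by
  simp only [Set.eq_empty_iff_forall_notMem, mem_termVars_subst]
  push Not
  exact ⟨fun h x hx y => h y x hx, fun h y x hx => h x hx y⟩

theorem mem_termFuncs_subst {t : L.Term ℕ} {σ : Subst L} {f : Σ n, L.Functions n} :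
    f ∈ termFuncs (t.subst σ) ↔ f ∈ termFuncs t ∨ ∃ x ∈ termVars t, f ∈ termFuncs (σ x) := by
  induction t with
  | var x => simp
  | func g ts ih =>
    simp only [subst_func, termFuncs_func, Set.mem_insert_iff, Set.mem_iUnion, ih, termVars_func]
    grind

theorem finite_termFuncs (t : L.Term ℕ) : (termFuncs t).Finite := by
  induction t with
  | var x => simp
  | func f ts ih => exact (Set.finite_iUnion ih).insert _

/-- The number of symbols of a term. -/
def termSize : L.Term ℕ → ℕ
  | .var _ => 1
  | .func _ ts => 1 + ∑ i, termSize (ts i)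

@[simp] theorem termSize_var (x : ℕ) : termSize (Term.var x : L.Term ℕ) = 1 := by
  rw [termSize]

@[simp] theorem termSize_func {n : ℕ} (f : L.Functions n) (ts : Fin n → L.Term ℕ) :
    termSize (Term.func f ts) = 1 + ∑ i, termSize (ts i) := by
  rw [termSize]

theorem termSize_pos (t : L.Term ℕ) : 0 < termSize t := by
  cases t <;> simp

theorem termSize_le_subst {t : L.Term ℕ} (σ : Subst L) {x : ℕ} (hx : x ∈ termVars t) :
    termSize (σ x) ≤ termSize (t.subst σ) := by
  induction t with
  | var y => simp_all
  | func f ts ih =>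
    simp only [termVars_func, Set.mem_iUnion] at hx
    obtain ⟨i, hi⟩ := hx
    have := Finset.single_le_sum (f := fun i => termSize ((ts i).subst σ))
      (fun _ _ => Nat.zero_le _) (Finset.mem_univ i)
    have := ih i hi
    simp only [subst_func, termSize_func]
    omega

/-- A strict decrease used twice: for the occurs check in unification, and to exclude infinite input
chains in lifted derivations. -/
theorem termSize_lt_subst_func {n : ℕ} {f : L.Functions n} {ts : Fin n → L.Term ℕ} (σ : Subst L)
    {x : ℕ} (hx : x ∈ termVars (Term.func f ts)) :
    termSize (σ x) < termSize ((Term.func f ts).subst σ) := by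
  simp only [termVars_func, Set.mem_iUnion] at hx
  obtain ⟨i, hi⟩ := hx
  have := Finset.single_le_sum (f := fun i => termSize ((ts i).subst σ))
    (fun _ _ => Nat.zero_le _) (Finset.mem_univ i)
  have := termSize_le_subst σ hi
  simp only [subst_func, termSize_func]
  omega

end Terms

/-! ### Substitution in atoms, literals and clauses; finiteness of variables and symbols -/

section Atoms

theorem Atom.subst_subst (A : Atom L) (σ τ : Subst L) :
    (A.subst σ).subst τ = A.subst fun x => (σ x).subst τ := by
  simp [Atom.subst, LP.subst_subst]

theorem Atom.subst_congr_iff {A : Atom L} {σ τ : Subst L} :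
    A.subst σ = A.subst τ ↔ ∀ x ∈ A.vars, σ x = τ x := by
  simp only [Atom.subst, Atom.mk.injEq, heq_eq_eq, true_and, Atom.vars, Set.mem_iUnion,
    funext_iff, LP.subst_congr_iff]
  exact ⟨fun h x ⟨i, hi⟩ => h i x hi, fun h i x hi => h x ⟨i, hi⟩⟩

theorem Atom.subst_congr {A : Atom L} {σ τ : Subst L} (h : ∀ x ∈ A.vars, σ x = τ x) :
    A.subst σ = A.subst τ := Atom.subst_congr_iff.2 h

@[simp] theorem Atom.subst_id (A : Atom L) : A.subst (fun x => Term.var x) = A := by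
  simp [Atom.subst]

theorem Atom.subst_eq_self {A : Atom L} {σ : Subst L} (h : ∀ x ∈ A.vars, σ x = Term.var x) :
    A.subst σ = A := by
  rw [Atom.subst_congr h, Atom.subst_id]

theorem Atom.Ground.subst {A : Atom L} (h : A.Ground) (σ : Subst L) : A.subst σ = A :=
  Atom.subst_eq_self (by simp [show A.vars = ∅ from h])

theorem Atom.mem_vars_subst {A : Atom L} {σ : Subst L} {y : ℕ} :
    y ∈ (A.subst σ).vars ↔ ∃ x ∈ A.vars, y ∈ termVars (σ x) := by
  simp only [Atom.vars, Atom.subst, Set.mem_iUnion, mem_termVars_subst]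
  exact ⟨fun ⟨i, x, h, h'⟩ => ⟨x, ⟨i, h⟩, h'⟩, fun ⟨x, ⟨i, h⟩, h'⟩ => ⟨i, x, h, h'⟩⟩

theorem Atom.mem_funcs_subst {A : Atom L} {σ : Subst L} {f : Σ n, L.Functions n} :
    f ∈ (A.subst σ).funcs ↔ f ∈ A.funcs ∨ ∃ x ∈ A.vars, f ∈ termFuncs (σ x) := by
  simp only [Atom.vars, Atom.funcs, Atom.subst, Set.mem_iUnion, mem_termFuncs_subst]
  grind

theorem Atom.finite_vars (A : Atom L) : A.vars.Finite :=
  Set.finite_iUnion fun _ => finite_termVars _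

theorem Atom.finite_funcs (A : Atom L) : A.funcs.Finite :=
  Set.finite_iUnion fun _ => finite_termFuncs _

@[simp] theorem Atom.predSymbol_subst (A : Atom L) (σ : Subst L) :
    (A.subst σ).predSymbol = A.predSymbol := rfl

@[simp] theorem Literal.atom_subst (l : Literal L) (σ : Subst L) :
    (l.subst σ).atom = l.atom.subst σ := by
  cases l <;> rfl

theorem Literal.subst_subst (l : Literal L) (σ τ : Subst L) :
    (l.subst σ).subst τ = l.subst fun x => (σ x).subst τ := by
  cases l <;> simp [Literal.subst, Atom.subst_subst]

theorem Literal.subst_congr {l : Literal L} {σ τ : Subst L} (h : ∀ x ∈ l.atom.vars, σ x = τ x) :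
    l.subst σ = l.subst τ := by
  cases l <;> exact congrArg _ (Atom.subst_congr h)

@[simp] theorem Literal.subst_id (l : Literal L) : l.subst (fun x => Term.var x) = l := by
  cases l <;> simp [Literal.subst]

theorem Literal.subst_eq_self {l : Literal L} {σ : Subst L}
    (h : ∀ x ∈ l.atom.vars, σ x = Term.var x) : l.subst σ = l := by
  rw [Literal.subst_congr h, Literal.subst_id]

theorem mem_litVars {G : List (Literal L)} {x : ℕ} :
    x ∈ litVars G ↔ ∃ l ∈ G, x ∈ l.atom.vars := Iff.rfl

@[simp] theorem litVars_nil : litVars ([] : List (Literal L)) = ∅ := by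
  ext; simp [mem_litVars]

@[simp] theorem litVars_cons (l : Literal L) (G : List (Literal L)) :
    litVars (l :: G) = l.atom.vars ∪ litVars G := by
  ext; simp [mem_litVars]

theorem mem_litVars_map_subst {G : List (Literal L)} {σ : Subst L} {y : ℕ} :
    y ∈ litVars (G.map (Literal.subst σ)) ↔ ∃ x ∈ litVars G, y ∈ termVars (σ x) := by
  simp only [mem_litVars, List.mem_map, exists_exists_and_eq_and, Literal.atom_subst,
    Atom.mem_vars_subst]
  grind

theorem finite_litVars (G : List (Literal L)) : (litVars G).Finite := by
  induction G with
  | nil => simp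
  | cons l G ih => simpa using ⟨l.atom.finite_vars, ih⟩

theorem Clause.finite_vars (C : Clause L) : C.vars.Finite :=
  C.head.finite_vars.union (finite_litVars _)

theorem Clause.finite_funcs (C : Clause L) : C.funcs.Finite := by
  refine C.head.finite_funcs.union ?_
  have : {f | ∃ l ∈ C.body, f ∈ l.atom.funcs} = ⋃ l ∈ {l | l ∈ C.body}, l.atom.funcs := by
    ext; simp
  rw [this]
  exact (List.finite_toSet C.body).biUnion fun l _ => l.atom.finite_funcs

theorem Program.finite_funcs (P : Program L) : P.funcs.Finite := by
  have : P.funcs = ⋃ C ∈ {C | C ∈ P}, C.funcs := by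
    ext; simp [Program.funcs]
  rw [this]
  exact (List.finite_toSet P).biUnion fun C _ => C.finite_funcs

/-- The goal obtained by applying a substitution to every literal. -/
def goalSubst (G : List (Literal L)) (σ : Subst L) : List (Literal L) := G.map (Literal.subst σ)

@[simp] theorem goalSubst_id (G : List (Literal L)) : goalSubst G (fun x => Term.var x) = G :=
  (List.map_congr_left fun l _ => l.subst_id).trans (List.map_id G)

theorem Clause.mem_vars {C : Clause L} {x : ℕ} :
    x ∈ C.vars ↔ x ∈ C.head.vars ∨ x ∈ litVars C.body := Iff.rfl

theorem Clause.mem_vars_subst {C : Clause L} {σ : Subst L} {y : ℕ} :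
    y ∈ (C.subst σ).vars ↔ ∃ x ∈ C.vars, y ∈ termVars (σ x) := by
  simp only [Clause.mem_vars, Clause.subst, Atom.mem_vars_subst, mem_litVars_map_subst]
  grind

theorem Clause.subst_subst (C : Clause L) (σ τ : Subst L) :
    (C.subst σ).subst τ = C.subst fun x => (σ x).subst τ := by
  simp [Clause.subst, Atom.subst_subst, Literal.subst_subst]

end Atoms

/-! ### Most general unifiers with a prescribed orientation of variable pairs -/

section Unification

/-- `σ` unifies the two sides of every equation of `E`. -/
def Unifies (E : List (L.Term ℕ × L.Term ℕ)) (σ : Subst L) : Prop :=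
  ∀ e ∈ E, e.1.subst σ = e.2.subst σ

/-- The variables of a list of equations. -/
def eqVars (E : List (L.Term ℕ × L.Term ℕ)) : Set ℕ :=
  {x | ∃ e ∈ E, x ∈ termVars e.1 ∨ x ∈ termVars e.2}

/-- `θ` is an idempotent relevant most general unifier of `E` that replaces variables only by terms
that are not variables of lower rank. -/
structure IsRankedMgu (r : ℕ → ℕ) (E : List (L.Term ℕ × L.Term ℕ)) (θ : Subst L) : Prop where
  unifies : Unifies E θ
  most_general : ∀ σ, Unifies E σ → ∀ x, (θ x).subst σ = σ x
  relevant : ∀ x, θ x ≠ Term.var x → x ∈ eqVars E ∧ termVars (θ x) ⊆ eqVars E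
  rank : ∀ x y, θ x = Term.var y → r x ≤ r y

/-- The total size of the left-hand sides of the instances of the equations. -/
def eqSize (σ : Subst L) (E : List (L.Term ℕ × L.Term ℕ)) : ℕ :=
  (E.map fun e => termSize (e.1.subst σ)).sum

@[simp] theorem unifies_cons {e : L.Term ℕ × L.Term ℕ} {E : List (L.Term ℕ × L.Term ℕ)}
    {σ : Subst L} : Unifies (e :: E) σ ↔ e.1.subst σ = e.2.subst σ ∧ Unifies E σ := by
  simp [Unifies]

theorem IsRankedMgu.congr {r : ℕ → ℕ} {E F : List (L.Term ℕ × L.Term ℕ)} {θ : Subst L}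
    (h : IsRankedMgu r E θ) (hu : ∀ σ, Unifies E σ ↔ Unifies F σ) (hv : eqVars E ⊆ eqVars F) :
    IsRankedMgu r F θ where
  unifies := (hu θ).1 h.unifies
  most_general σ hσ := h.most_general σ ((hu σ).2 hσ)
  relevant x hx := ⟨hv (h.relevant x hx).1, (h.relevant x hx).2.trans hv⟩
  rank := h.rank

/-- The substitution that replaces only `x`, by `t`. -/
def single (x : ℕ) (t : L.Term ℕ) : Subst L := fun z => if z = x then t else Term.var z

theorem single_subst {x : ℕ} {t : L.Term ℕ} {σ : Subst L} (h : σ x = t.subst σ) (z : ℕ) :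
    (single x t z).subst σ = σ z := by
  unfold single; split_ifs with hz
  · rw [hz, h]
  · rfl

/-- The instances of equations. -/
def eqSubst (E : List (L.Term ℕ × L.Term ℕ)) (σ : Subst L) : List (L.Term ℕ × L.Term ℕ) :=
  E.map fun e => (e.1.subst σ, e.2.subst σ)

theorem unifies_eqSubst {E : List (L.Term ℕ × L.Term ℕ)} {σ τ : Subst L} :
    Unifies (eqSubst E σ) τ ↔ Unifies E fun x => (σ x).subst τ := by
  simp only [Unifies, eqSubst, List.forall_mem_map, subst_subst]

theorem eqSize_eqSubst {E : List (L.Term ℕ × L.Term ℕ)} {σ τ : Subst L} :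
    eqSize τ (eqSubst E σ) = eqSize (fun x => (σ x).subst τ) E := by
  simp [eqSize, eqSubst, subst_subst, Function.comp_def]

/-- The variable elimination rule. The occurs check `hx` makes `single x t` fix `t`, and `hr` keeps
the orientation intact when `t` is itself a variable. -/
theorem IsRankedMgu.eliminate {r : ℕ → ℕ} {E : List (L.Term ℕ × L.Term ℕ)} {θ : Subst L} {x : ℕ}
    {t : L.Term ℕ} (hx : x ∉ termVars t) (hr : ∀ y, t = Term.var y → r x ≤ r y)
    (h : IsRankedMgu r (eqSubst E (single x t)) θ) :
    IsRankedMgu r ((Term.var x, t) :: E) fun z => (single x t z).subst θ := by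
  have hv : eqVars (eqSubst E (single x t)) ⊆ eqVars ((Term.var x, t) :: E) := by
    rintro y ⟨_, he', hy⟩
    obtain ⟨e, he, rfl⟩ := List.mem_map.1 he'
    simp only [mem_termVars_subst, single] at hy
    rcases hy with ⟨z, hz, hy⟩ | ⟨z, hz, hy⟩ <;> split_ifs at hy with hzx
    · exact ⟨_, List.mem_cons_self, Or.inr hy⟩
    · simp only [termVars_var, Set.mem_singleton_iff] at hy
      exact ⟨e, List.mem_cons_of_mem _ he, Or.inl (hy ▸ hz)⟩
    · exact ⟨_, List.mem_cons_self, Or.inr hy⟩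
    · simp only [termVars_var, Set.mem_singleton_iff] at hy
      exact ⟨e, List.mem_cons_of_mem _ he, Or.inr (hy ▸ hz)⟩
  have ht : t.subst (single x t) = t := subst_eq_self fun z hz => by
    have : z ≠ x := fun h => hx (h ▸ hz)
    simp [single, this]
  refine ⟨?_, ?_, ?_, ?_⟩
  · rw [unifies_cons, ← unifies_eqSubst]
    refine ⟨?_, h.unifies⟩
    simp only [subst_var]
    rw [← subst_subst t, ht]; simp [single]
  · intro σ hσ z
    rw [unifies_cons] at hσ
    have hs : (fun z => (single x t z).subst σ) = σ := funext (single_subst hσ.1)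
    have : Unifies (eqSubst E (single x t)) σ := by
      rw [unifies_eqSubst, hs]; exact hσ.2
    rw [subst_subst, subst_congr fun y _ => h.most_general σ this y]
    exact single_subst hσ.1 z
  · intro z hz
    by_cases hzx : z = x
    · subst hzx
      refine ⟨⟨_, List.mem_cons_self, Or.inl (by simp)⟩, fun y hy => ?_⟩
      simp only [single, if_true] at hy
      obtain ⟨w, hw, hy⟩ := mem_termVars_subst.1 hy
      by_cases hwθ : θ w = Term.var w
      · rw [hwθ] at hy
        simp only [termVars_var, Set.mem_singleton_iff] at hy
        exact ⟨_, List.mem_cons_self, Or.inr (hy ▸ hw)⟩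
      · exact hv ((h.relevant w hwθ).2 hy)
    · simp only [single, hzx, if_false, subst_var] at hz ⊢
      exact ⟨hv (h.relevant z hz).1, (h.relevant z hz).2.trans hv⟩
  · intro z y hzy
    by_cases hzx : z = x
    · subst hzx
      simp only [single, if_true] at hzy
      cases t with
      | var w => exact (hr w rfl).trans (h.rank w y hzy)
      | func f ts => simp at hzy
    · simp only [single, hzx, if_false, subst_var] at hzy
      exact h.rank z y hzy

theorem eqSize_cons {e : L.Term ℕ × L.Term ℕ} {E : List (L.Term ℕ × L.Term ℕ)} {σ : Subst L} :
    eqSize σ (e :: E) = termSize (e.1.subst σ) + eqSize σ E := by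
  simp [eqSize]

/-- Unifiable equations have an idempotent relevant most general unifier, with variables oriented
by any given rank. -/
theorem exists_isRankedMgu (r : ℕ → ℕ) (σ : Subst L) (N : ℕ) (E : List (L.Term ℕ × L.Term ℕ))
    (hσ : Unifies E σ) (hN : eqSize σ E ≤ N) : ∃ θ, IsRankedMgu r E θ := by
  induction N generalizing E with
  | zero =>
    cases E with
    | nil => exact ⟨fun x => Term.var x, by simp [Unifies], by simp, by simp,
        fun x y h => by cases h; rfl⟩
    | cons e E =>
      rw [eqSize_cons] at hN
      have := termSize_pos (e.1.subst σ)
      omega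
  | succ N ih =>
    -- The measure is taken under the fixed unifier `σ`. Since `σ x = t.subst σ`, eliminating `x`
    -- does not change the `σ`-instances of the remaining equations, so dropping one equation lowers
    -- the measure.
    have elim : ∀ (x : ℕ) (t : L.Term ℕ) (F : List (L.Term ℕ × L.Term ℕ)), t ≠ Term.var x →
        (∀ y, t = Term.var y → r x ≤ r y) → Unifies ((Term.var x, t) :: F) σ →
        eqSize σ ((Term.var x, t) :: F) ≤ N + 1 → ∃ θ, IsRankedMgu r ((Term.var x, t) :: F) θ := by
      intro x t F htx hr hF hs
      rw [unifies_cons] at hF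
      have hx : x ∉ termVars t := by
        intro hx
        cases t with
        | var y => simp at hx; simp [hx] at htx
        | func f ts =>
          have := termSize_lt_subst_func σ hx
          have h2 := hF.1
          simp only [subst_var] at h2
          rw [← h2] at this
          omega
      have hs' : (fun z => (single x t z).subst σ) = σ := funext (single_subst hF.1)
      obtain ⟨θ, hθ⟩ := ih (eqSubst F (single x t)) (by rw [unifies_eqSubst, hs']; exact hF.2) (by
        rw [eqSize_eqSubst, hs']
        rw [eqSize_cons] at hs
        have := termSize_pos ((Term.var x, t).1.subst σ)
        omega)
      exact ⟨_, hθ.eliminate hx hr⟩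
    have swap : ∀ (s t : L.Term ℕ) (F : List (L.Term ℕ × L.Term ℕ)),
        (∃ θ, IsRankedMgu r ((t, s) :: F) θ) → ∃ θ, IsRankedMgu r ((s, t) :: F) θ := by
      rintro s t F ⟨θ, hθ⟩
      refine ⟨θ, hθ.congr (fun τ => by simp [eq_comm]) ?_⟩
      rintro x ⟨e, he, hx⟩
      rcases List.mem_cons.1 he with rfl | he
      · exact ⟨_, List.mem_cons_self, hx.symm⟩
      · exact ⟨e, List.mem_cons_of_mem _ he, hx⟩
    match E, hσ, hN with
    | [], _, _ =>
      exact ⟨fun x => Term.var x, by simp [Unifies], by simp, by simp,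
        fun x y h => by cases h; rfl⟩
    -- Only this case leaves a choice of direction: the variable of lower rank is the one replaced.
    | (Term.var x, Term.var y) :: F, hσ, hN =>
      by_cases hxy : x = y
      · subst hxy
        rw [eqSize_cons] at hN
        have := termSize_pos (((Term.var x : L.Term ℕ), (Term.var x : L.Term ℕ)).1.subst σ)
        obtain ⟨θ, hθ⟩ := ih F (unifies_cons.1 hσ).2 (by omega)
        refine ⟨θ, hθ.congr (fun τ => by simp) ?_⟩
        rintro z ⟨e, he, hz⟩
        exact ⟨e, List.mem_cons_of_mem _ he, hz⟩
      · rcases le_total (r x) (r y) with h | h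
        · exact elim x _ F (fun h => hxy (by cases h; rfl)) (fun z hz => by cases hz; exact h) hσ hN
        · refine swap _ _ _ (elim y _ F (fun h => hxy (by cases h; rfl))
            (fun z hz => by cases hz; exact h) ?_ ?_)
          · simpa [eq_comm] using hσ
          · have := (unifies_cons.1 hσ).1
            simp only [eqSize_cons] at hN ⊢
            simp only [← this]
            exact hN
    | (Term.var x, Term.func f ts) :: F, hσ, hN =>
      exact elim x _ F (by simp) (by simp) hσ hN
    | (Term.func f ts, Term.var x) :: F, hσ, hN =>
      refine swap _ _ _ (elim x _ F (by simp) (by simp) ?_ ?_)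
      · rw [unifies_cons] at hσ ⊢
        exact ⟨hσ.1.symm, hσ.2⟩
      · have := (unifies_cons.1 hσ).1
        simp only [eqSize_cons] at hN ⊢
        simp only [← this]
        exact hN
    -- Decomposition into the equations between arguments; the measure drops by the leading symbol.
    | (Term.func (l := n) f ts, Term.func (l := m) g us) :: F, hσ, hN =>
      have h := (unifies_cons.1 hσ).1
      simp only [subst_func, Term.func.injEq] at h
      obtain ⟨rfl, hfg, -⟩ := h
      cases hfg
      have hu : ∀ τ, Unifies ((List.ofFn fun i => (ts i, us i)) ++ F) τ ↔
          Unifies ((Term.func f ts, Term.func f us) :: F) τ := by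
        intro τ
        simp only [Unifies, List.mem_append, List.mem_ofFn, List.mem_cons]
        constructor
        · rintro h e (rfl | he)
          · simp only [subst_func, Term.func.injEq, heq_eq_eq, true_and]
            funext i
            exact h _ (Or.inl ⟨i, rfl⟩)
          · exact h e (Or.inr he)
        · rintro h e (⟨i, rfl⟩ | he)
          · have := h _ (Or.inl rfl)
            simp only [subst_func, Term.func.injEq, heq_eq_eq, true_and] at this
            exact congrFun this i
          · exact h e (Or.inr he)
      obtain ⟨θ, hθ⟩ := ih _ ((hu σ).2 hσ) (by
        rw [eqSize_cons] at hN
        simp only [eqSize, List.map_append, List.map_ofFn, List.sum_append, List.sum_ofFn,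
          Function.comp_def, subst_func, termSize_func] at hN ⊢
        omega)
      refine ⟨θ, hθ.congr hu ?_⟩
      rintro x ⟨e, he, hx⟩
      rcases List.mem_append.1 he with he | he
      · obtain ⟨i, rfl⟩ := (List.mem_ofFn' _ _).1 he
        refine ⟨_, List.mem_cons_self, ?_⟩
        simp only [termVars_func, Set.mem_iUnion]
        exact hx.imp (fun h => ⟨i, h⟩) fun h => ⟨i, h⟩
      · exact ⟨e, List.mem_cons_of_mem _ he, hx⟩

end Unification

/-! ### Resolution steps: existence, idempotence and lifting -/

section Resolution

/-- Unifiable atoms have an idempotent relevant most general unifier, with variables oriented by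
any given rank. -/
theorem Atom.exists_mgu (r : ℕ → ℕ) {A H : Atom L} {σ : Subst L} (h : A.subst σ = H.subst σ) :
    ∃ θ : Subst L, A.subst θ = H.subst θ ∧
      (∀ τ : Subst L, A.subst τ = H.subst τ → ∀ x, (θ x).subst τ = τ x) ∧
      (∀ x, θ x ≠ Term.var x → x ∈ A.vars ∪ H.vars ∧ termVars (θ x) ⊆ A.vars ∪ H.vars) ∧
      ∀ x y, θ x = Term.var y → r x ≤ r y := by
  obtain ⟨n, p, ts⟩ := A
  obtain ⟨m, q, us⟩ := H
  simp only [Atom.subst, Atom.mk.injEq] at h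
  obtain ⟨rfl, hpq, h⟩ := h
  cases hpq
  have hu : ∀ τ, Unifies (List.ofFn fun i => (ts i, us i)) τ ↔
      Atom.subst ⟨n, p, ts⟩ τ = Atom.subst ⟨n, p, us⟩ τ := by
    intro τ
    simp only [Unifies, List.mem_ofFn, Atom.subst, Atom.mk.injEq, heq_eq_eq, true_and, funext_iff]
    exact ⟨fun h i => h _ ⟨i, rfl⟩, by rintro h _ ⟨i, rfl⟩; exact h i⟩
  have hv : eqVars (List.ofFn fun i => (ts i, us i)) =
      Atom.vars ⟨n, p, ts⟩ ∪ Atom.vars ⟨n, p, us⟩ := by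
    ext x
    simp only [eqVars, List.mem_ofFn, Set.mem_ofPred_eq, Atom.vars, Set.mem_union, Set.mem_iUnion]
    constructor
    · rintro ⟨_, ⟨i, rfl⟩, h | h⟩
      exacts [Or.inl ⟨i, h⟩, Or.inr ⟨i, h⟩]
    · rintro (⟨i, h⟩ | ⟨i, h⟩)
      exacts [⟨_, ⟨i, rfl⟩, Or.inl h⟩, ⟨_, ⟨i, rfl⟩, Or.inr h⟩]
  obtain ⟨θ, hθ⟩ := exists_isRankedMgu r σ _ _ ((hu σ).2 (by simpa [Atom.subst] using h)) le_rfl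
  exact ⟨θ, (hu θ).1 hθ.unifies, fun τ hτ => hθ.most_general τ ((hu τ).2 hτ),
    fun x hx => hv ▸ hθ.relevant x hx, hθ.rank⟩

/-- Finitely many variables can be renamed apart from finitely many others. -/
theorem exists_perm_disjoint {S T : Set ℕ} (hS : S.Finite) (hT : T.Finite) :
    ∃ e : Equiv.Perm ℕ, ∀ x ∈ S, e x ∉ T := by
  obtain ⟨N, hN⟩ := (hS.union hT).bddAbove
  -- The permutation interchanges the blocks `[0, N]` and `[N + 1, 2 * N + 1]`, where `N` bounds
  -- both sets.
  have hinv : Function.Involutive fun x =>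
      if x ≤ N then x + (N + 1) else if x ≤ 2 * N + 1 then x - (N + 1) else x := by
    intro x
    simp only
    grind
  refine ⟨hinv.toPerm, fun x hx hxT => ?_⟩
  have h1 := hN (Or.inl hx)
  have h2 := hN (Or.inr hxT)
  simp only [Function.Involutive.coe_toPerm, if_pos h1] at h2
  omega

/-- `θ` is a unifier, so `most_general` applies to `θ` itself. -/
theorem Resolves.idempotent {inputs used : Set ℕ} {A : Atom L} {C C' : Clause L} {θ : Subst L}
    (h : Resolves inputs used A C C' θ) {x y : ℕ} (hy : y ∈ termVars (θ x)) :
    θ y = Term.var y :=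
  subst_eq_self_iff.1 (h.most_general θ h.unifies x) y hy

/-- If an instance of `A` resolves with a clause, then so does `A`. -/
theorem Resolves.exists_lift {inputs' used' inputs used : Set ℕ} {A : Atom L} {C C'' : Clause L}
    {σ θ' : Subst L} (h : Resolves inputs' used' (A.subst σ) C C'' θ') (hin : inputs ⊆ used)
    (hused : used.Finite) (hA : A.vars ⊆ used) : ∃ C' θ, Resolves inputs used A C C' θ := by
  obtain ⟨e'', hC''⟩ := h.variant
  obtain ⟨e, he⟩ := exists_perm_disjoint C.finite_vars hused
  set C' := C.subst fun x => Term.var (e x) with hC'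
  have hfresh : Disjoint C'.vars used := by
    rw [Set.disjoint_left]
    intro y hy
    obtain ⟨x, hx, hy⟩ := Clause.mem_vars_subst.1 hy
    simp only [termVars_var, Set.mem_singleton_iff] at hy
    exact hy ▸ he x hx
  classical
  have hunif : ∃ τ : Subst L, A.subst τ = C'.head.subst τ := by
    -- Used variables follow `σ` and then `θ'`; a renamed clause variable is translated back to its
    -- name in `C''` before `θ'` is applied.
    refine ⟨fun x => if x ∈ used then (σ x).subst θ' else θ' (e'' (e.symm x)), ?_⟩
    rw [Atom.subst_congr (τ := fun x => (σ x).subst θ'), ← Atom.subst_subst, h.unifies, hC'', hC']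
    · simp only [Clause.subst, Atom.subst_subst, subst_var]
      refine Atom.subst_congr fun x hx => ?_
      simp [he x (Or.inl hx)]
    · intro x hx
      simp [hA hx]
  obtain ⟨τ, hτ⟩ := hunif
  -- Input variables rank above other goal variables, and these above clause variables. Replacement
  -- never lowers the rank, which gives both orientation conventions at once.
  obtain ⟨θ, h1, h2, h3, h4⟩ := Atom.exists_mgu
    (fun x => if x ∈ inputs then 2 else if x ∈ A.vars then 1 else 0) hτ
  refine ⟨C', θ, ⟨e, hC'⟩, hfresh, h1, h2, h3, ?_, ?_⟩
  · intro x hx y hxy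
    by_cases hne : θ x = Term.var x
    · rw [hne] at hxy; cases hxy; exact hx
    · have hy : y ∈ A.vars ∪ C'.head.vars := (h3 x hne).2 (by simp [hxy])
      have hr := h4 x y hxy
      by_contra hyA
      have hyH : y ∈ C'.head.vars := hy.resolve_left hyA
      have : y ∉ inputs := fun h => Set.disjoint_left.1 hfresh (Or.inl hyH) (hin h)
      simp only [this, hyA, hx, if_true, if_false] at hr
      split_ifs at hr <;> omega
  · intro x hx y hxy
    have hr := h4 x y hxy
    by_contra hy
    simp only [hx, hy, if_true, if_false] at hr
    split_ifs at hr <;> omega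

/-- If `A` and an instance of `A` resolve with variants of the same clause, then the resolvent
of the instance is an instance of the resolvent. -/
theorem Resolves.exists_instance {inputs used inputs' used' : Set ℕ} {A : Atom L}
    {C C' C'' : Clause L} {σ θ θ' : Subst L} (h : Resolves inputs used A C C' θ)
    (h' : Resolves inputs' used' (A.subst σ) C C'' θ') (hA : A.vars ⊆ used)
    {rest : List (Literal L)} (hrest : litVars rest ⊆ used) :
    ∃ τ : Subst L, (∀ x ∈ used, τ x = (σ x).subst θ') ∧ (∀ x, (θ x).subst τ = τ x) ∧
      C'.body.map (fun l => (l.subst θ).subst τ) = C''.body.map (Literal.subst θ') ∧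
      rest.map (fun l => (l.subst θ).subst τ) = rest.map (fun l => (l.subst σ).subst θ') := by
  obtain ⟨e'', hC''⟩ := h'.variant
  obtain ⟨e, hC'⟩ := h.variant
  classical
  -- This glues the two sides: `σ` followed by `θ'` on used variables, and the change of variant
  -- followed by `θ'` on the fresh ones. It unifies `A` with the head of `C'`, hence factors through
  -- `θ`.
  let τ : Subst L := fun x => if x ∈ used then (σ x).subst θ' else θ' (e'' (e.symm x))
  have hτ : ∀ x ∈ used, τ x = (σ x).subst θ' := fun x hx => if_pos hx
  have he : ∀ x ∈ C.vars, e x ∉ used := fun x hx => Set.disjoint_left.1 h.fresh (by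
    rw [hC', Clause.mem_vars_subst]; exact ⟨x, hx, by simp⟩)
  have hCτ : C'.subst τ = C''.subst θ' := by
    rw [hC', hC'', Clause.subst_subst, Clause.subst_subst]
    simp only [Clause.subst, Clause.mk.injEq, subst_var]
    refine ⟨Atom.subst_congr fun x hx => ?_, List.map_congr_left fun l hl =>
      Literal.subst_congr fun x hx => ?_⟩
    · simp [τ, he x (Or.inl hx)]
    · simp [τ, he x (Or.inr ⟨l, hl, hx⟩)]
  have hAτ : A.subst τ = C'.head.subst τ := by
    rw [Atom.subst_congr fun x hx => hτ x (hA hx), ← Atom.subst_subst, h'.unifies]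
    exact (congrArg Clause.head hCτ).symm
  have hmg := h.most_general τ hAτ
  refine ⟨τ, hτ, hmg, ?_, ?_⟩
  · simp only [Literal.subst_subst, hmg]
    exact congrArg Clause.body hCτ
  · simp only [Literal.subst_subst, hmg]
    exact List.map_congr_left fun l hl => Literal.subst_congr fun x hx => hτ x (hrest ⟨l, hl, hx⟩)

end Resolution

/-! ### Independence of outcomes from the names of variables -/

section Variants

/-- Two goals are variants if each is an instance of the other. -/
def IsVariant (G G' : List (Literal L)) : Prop :=
  ∃ σ σ' : Subst L, G' = goalSubst G σ ∧ G = goalSubst G' σ'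

theorem IsVariant.refl (G : List (Literal L)) : IsVariant G G :=
  ⟨_, _, (goalSubst_id G).symm, (goalSubst_id G).symm⟩

theorem IsVariant.symm {G G' : List (Literal L)} (h : IsVariant G G') : IsVariant G' G :=
  let ⟨σ, σ', h1, h2⟩ := h
  ⟨σ', σ, h2, h1⟩

@[simp] theorem goalSubst_cons (l : Literal L) (G : List (Literal L)) (σ : Subst L) :
    goalSubst (l :: G) σ = l.subst σ :: goalSubst G σ := rfl

theorem IsVariant.tail {l l' : Literal L} {G G' : List (Literal L)}
    (h : IsVariant (l :: G) (l' :: G')) : IsVariant G G' := by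
  obtain ⟨σ, σ', h1, h2⟩ := h
  exact ⟨σ, σ', (List.cons.inj h1).2, (List.cons.inj h2).2⟩

theorem IsVariant.eq_nil {G : List (Literal L)} (h : IsVariant [] G) : G = [] :=
  let ⟨_, _, h, _⟩ := h; h

theorem IsVariant.exists_pos {A : Atom L} {rest G : List (Literal L)}
    (h : IsVariant (Literal.pos A :: rest) G) : ∃ A' rest', G = Literal.pos A' :: rest' :=
  let ⟨_, _, h, _⟩ := h; ⟨_, _, h⟩

theorem IsVariant.exists_neg {A : Atom L} (hA : A.Ground) {rest G : List (Literal L)}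
    (h : IsVariant (Literal.neg A :: rest) G) :
    ∃ rest', G = Literal.neg A :: rest' ∧ IsVariant rest rest' := by
  obtain ⟨σ, σ', h1, h2⟩ := h
  simp only [goalSubst_cons, Literal.subst, hA.subst] at h1
  subst h1
  exact ⟨_, rfl, IsVariant.tail ⟨σ, σ', by simp [Literal.subst, hA.subst], h2⟩⟩

theorem IsVariant.exists_resolves {A A' : Atom L} {rest rest' : List (Literal L)}
    (hv : IsVariant (Literal.pos A :: rest) (Literal.pos A' :: rest'))
    {inputs used inputs' used' : Set ℕ} {C C' : Clause L} {θ : Subst L}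
    (h : Resolves inputs' used' A' C C' θ) (hin : inputs ⊆ used) (hused : used.Finite)
    (hA : A.vars ⊆ used) : ∃ C' θ, Resolves inputs used A C C' θ := by
  obtain ⟨σ, -, h1, -⟩ := hv
  obtain rfl : A' = A.subst σ := by
    simpa [Literal.subst] using (List.cons.inj h1).1
  exact h.exists_lift hin hused hA

/-- `Resolves.exists_instance` is applied in both directions, each goal being an instance of the
other. In particular the choice of clause variant and unifier is immaterial. -/
theorem IsVariant.resolvent {A A' : Atom L} {rest rest' : List (Literal L)}
    (hv : IsVariant (Literal.pos A :: rest) (Literal.pos A' :: rest'))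
    {inputs used inputs' used' : Set ℕ} {C C' C'' : Clause L} {θ θ' : Subst L}
    (h : Resolves inputs used A C C' θ) (h' : Resolves inputs' used' A' C C'' θ')
    (hG : litVars (Literal.pos A :: rest) ⊆ used)
    (hG' : litVars (Literal.pos A' :: rest') ⊆ used') :
    IsVariant (resolvent C' rest θ) (resolvent C'' rest' θ') := by
  obtain ⟨σ, σ', h1, h2⟩ := hv
  obtain ⟨hA, h1⟩ := List.cons.inj h1
  obtain ⟨hA', h2⟩ := List.cons.inj h2
  simp only [Literal.subst, Literal.pos.injEq] at hA hA'
  simp only [litVars_cons, Set.union_subset_iff] at hG hG'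
  change rest' = goalSubst rest σ at h1
  change rest = goalSubst rest' σ' at h2
  obtain ⟨τ, -, -, hb, hr⟩ := h.exists_instance (hA ▸ h') hG.1 hG.2
  obtain ⟨τ', -, -, hb', hr'⟩ := h'.exists_instance (hA' ▸ h) hG'.1 hG'.2
  refine ⟨τ, τ', ?_, ?_⟩
  · simp only [LP.resolvent, goalSubst, List.map_append, List.map_map, Function.comp_def, hb, hr, h1]
  · simp only [LP.resolvent, goalSubst, List.map_append, List.map_map, Function.comp_def, hb', hr']
    conv_lhs => rw [h2]
    simp [goalSubst, Function.comp_def]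

/-- Variants of a goal have the same outcome. -/
theorem Outcome.of_isVariant {P : Program L} {b : Bool} {G G' : List (Literal L)}
    (h : Outcome P b G) (hv : IsVariant G G') : Outcome P b G' := by
  induction h generalizing G' with
  | success_nil => rw [hv.eq_nil]; exact .success_nil
  | success_pos A rest C C' θ hC hr _ ih =>
    obtain ⟨A', rest', rfl⟩ := hv.exists_pos
    obtain ⟨C'', θ', hr'⟩ := hv.symm.exists_resolves hr (Set.empty_subset _)
      (finite_litVars (Literal.pos A' :: rest')) (by rw [litVars_cons]; exact Set.subset_union_left)
    exact .success_pos A' rest' C C'' θ' hC hr' (ih (hv.resolvent hr hr' subset_rfl subset_rfl))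
  | success_neg A rest hA hf _ _ ih =>
    obtain ⟨rest', rfl, hv'⟩ := hv.exists_neg hA
    exact .success_neg A rest' hA hf (ih hv')
  | failure_pos A rest _ ih =>
    obtain ⟨A', rest', rfl⟩ := hv.exists_pos
    refine .failure_pos A' rest' fun C C'' θ' hC hr' => ?_
    obtain ⟨C', θ, hr⟩ := hv.exists_resolves hr' (Set.empty_subset _)
      (finite_litVars (Literal.pos A :: rest)) (by rw [litVars_cons]; exact Set.subset_union_left)
    exact ih C C' θ hC hr (hv.resolvent hr hr' subset_rfl subset_rfl)
  | failure_neg_leaf A rest hA hs _ =>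
    obtain ⟨rest', rfl, hv'⟩ := hv.exists_neg hA
    exact .failure_neg_leaf A rest' hA hs
  | failure_neg A rest hA hf _ _ ih =>
    obtain ⟨rest', rfl, hv'⟩ := hv.exists_neg hA
    exact .failure_neg A rest' hA hf (ih hv')

end Variants

/-! ### Bookkeeping of used variables along a path -/

section Nodes

/-- The literals of the goal at a node. -/
def Node.lits (N : Node L) : List (Literal L) := N.goal.map Subgoal.lit

/-- The variables of a node are recorded in the finite set of used variables. -/
structure Node.Proper (N : Node L) : Prop where
  finite : N.used.Finite
  inputs_subset : N.inputs ⊆ N.used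
  lits_subset : litVars N.lits ⊆ N.used

theorem Resolves.termVars_subset {inputs used : Set ℕ} {A : Atom L} {C C' : Clause L} {θ : Subst L}
    (h : Resolves inputs used A C C' θ) (x : ℕ) :
    termVars (θ x) ⊆ insert x (A.vars ∪ C'.head.vars) := by
  by_cases hx : θ x = Term.var x
  · simp [hx]
  · exact (h.relevant x hx).2.trans (Set.subset_insert _ _)

theorem Step.used_subset {P : Program L} {N N' : Node L} {θ : Subst L} (h : Step P N θ N') :
    N.used ⊆ N'.used := by
  cases h with
  | resolve => exact Set.subset_union_left
  | negArc => rfl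
  | negSuccess => rfl

theorem Step.termVars_subset {P : Program L} {N N' : Node L} {θ : Subst L} (h : Step P N θ N')
    (hN : N.Proper) {x : ℕ} (hx : x ∈ N'.used) : termVars (θ x) ⊆ N'.used := by
  have hl := hN.lits_subset
  cases h with
  | resolve n A anc rest used inputs sub k C C' θ hC hr hsub =>
    simp only [Node.lits, List.map_cons, litVars_cons, Set.union_subset_iff] at hl
    exact (hr.termVars_subset x).trans (Set.insert_subset hx (Set.union_subset_union hl.1
        Set.subset_union_left))
  | negArc => simpa [idSubst] using hx
  | negSuccess => simpa [idSubst] using hx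

theorem Step.proper {P : Program L} {N N' : Node L} {θ : Subst L} (h : Step P N θ N')
    (hN : N.Proper) : N'.Proper := by
  have key := fun x => h.termVars_subset hN (x := x)
  obtain ⟨hf, hi, hl⟩ := hN
  cases h with
  | resolve n A anc rest used inputs sub k C C' θ hC hr hsub =>
    simp only [Node.lits, List.map_cons, litVars_cons, Set.union_subset_iff] at hl
    refine ⟨hf.union C'.finite_vars, Set.iUnion₂_subset fun x hx => key x (Or.inl (hi hx)), ?_⟩
    rintro y ⟨l, hl', hy⟩
    simp only [Node.lits, List.map_append, List.map_map, List.mem_append, List.mem_map,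
      Function.comp_apply] at hl'
    rcases hl' with ⟨l', hl', rfl⟩ | ⟨s, hs, rfl⟩
    · rw [Literal.atom_subst, Atom.mem_vars_subst] at hy
      obtain ⟨x, hx, hy⟩ := hy
      exact key x (Or.inr (Or.inr ⟨l', hl', hx⟩)) hy
    · rw [Literal.atom_subst, Atom.mem_vars_subst] at hy
      obtain ⟨x, hx, hy⟩ := hy
      exact key x (Or.inl (hl.2 ⟨s.lit, List.mem_map_of_mem hs, hx⟩)) hy
  | negArc n A anc rest used inputs sub hA =>
    refine ⟨hf, hi, fun x hx => ?_⟩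
    have : A.vars = ∅ := hA
    simp [Node.lits, Literal.atom, this] at hx
  | negSuccess n A anc rest used inputs sub hA hout =>
    refine ⟨hf, hi, Set.Subset.trans ?_ hl⟩
    simp [Node.lits]

theorem rootNode_proper (Q : Atom L) {inputs : Set ℕ} (h : inputs.Finite) :
    (rootNode Q inputs).Proper :=
  ⟨Q.finite_vars.union h, Set.subset_union_right, by simp [rootNode, Node.lits, Literal.atom]⟩

theorem InfDerivation.proper {P : Program L} {root : Node L} (D : InfDerivation P root)
    (h : root.Proper) (n : ℕ) : (D.node n).Proper := by
  induction n with
  | zero => rw [D.node_zero]; exact h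
  | succ n ih => exact (D.step n).proper ih

theorem Step.depth {P : Program L} {N N' : Node L} {θ : Subst L} (h : Step P N θ N') :
    N'.depth = N.depth + 1 := by
  cases h <;> rfl

end Nodes

/-! ### Lifting derivations from the forest to the moded tree -/

section Lifting

/-- The node `N` is an instance of `M` under the substitution `σ`, which is ground on the input
variables of `M`; in a subsidiary tree it is even a variant. -/
structure Lifts (N M : Node L) (σ : Subst L) : Prop where
  depth : N.depth = M.depth
  goal : N.goal = M.goal.map fun s => ⟨s.lit.subst σ, s.anc⟩
  subsidiary : N.subsidiary ↔ M.subsidiary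
  ground : ∀ x ∈ M.inputs, termVars (σ x) = ∅
  variant : M.subsidiary → IsVariant M.lits N.lits

/-- The lifting lemma. Values that are already ground never change later, and `(θ x).subst σ' = σ'
x` ties each replaced variable to its replacement; these two facts make the sizes along an input
chain comparable. -/
theorem Lifts.exists_step {P : Program L} {N N' M : Node L} {σ θ' : Subst L} (h : Lifts N M σ)
    (hN : N.Proper) (hM : M.Proper)
    (hfl : ∀ A anc rest, M.goal = ⟨Literal.neg A, anc⟩ :: rest → A.Ground)
    (hstep : Step P N θ' N') :
    ∃ θ M' σ', Step P M θ M' ∧ Lifts N' M' σ' ∧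
      (∀ x ∈ M.used, termVars (σ x) = ∅ → σ' x = σ x) ∧ ∀ x, (θ x).subst σ' = σ' x := by
  obtain ⟨hd, hg, hs, hgr, hv⟩ := h
  obtain ⟨m, goal, used, inputs, sub⟩ := M
  cases hstep with
  | resolve n A' anc rest' used' inputs' sub' k C C'' θ' hC hr hsub =>
    obtain rfl : n = m := hd
    obtain ⟨⟨l, anc⟩, rest, rfl, hl, rfl⟩ := List.map_eq_cons_iff.1 hg.symm
    simp only [Subgoal.mk.injEq] at hl
    obtain ⟨hl, rfl⟩ := hl
    cases l with
    | neg B => simp [Literal.subst] at hl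
    | pos A =>
    simp only [Literal.subst, Literal.pos.injEq] at hl
    subst hl
    obtain ⟨hMf, hMi, hMl⟩ := hM
    have hMl' := hMl
    simp only [Node.lits, List.map_cons, litVars_cons, Set.union_subset_iff, Literal.atom] at hMl'
    obtain ⟨C', θ, hr0⟩ := hr.exists_lift hMi hMf hMl'.1
    obtain ⟨τ, hτ, hmg, hb, hrest⟩ := hr0.exists_instance hr hMl'.1 hMl'.2
    have hτg : ∀ x ∈ used, termVars (σ x) = ∅ → τ x = σ x := fun x hx h => by
      rw [hτ x hx, subst_of_ground h]
    refine ⟨θ, _, τ, .resolve n A anc rest used inputs sub k C C' θ hC hr0 ?_, ?_, hτg, hmg⟩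
    -- An earlier clause with a success above would, by invariance under variants, give one for the
    -- instance below, where the stopping rule excludes it.
    · intro hsub1 j hj E E' η hE hres hout
      have hv := hv hsub1
      simp only [Node.lits, List.map_cons] at hv
      obtain ⟨E'', η', hres'⟩ := hv.symm.exists_resolves hres (Set.empty_subset _)
        (finite_litVars (Literal.pos (A.subst σ) ::
          (rest.map fun s => (⟨s.lit.subst σ, s.anc⟩ : Subgoal L)).map Subgoal.lit)) (by
          rw [litVars_cons]; exact Set.subset_union_left)
      exact hsub (hs.2 hsub1) j hj E E'' η' hE hres'
        (hout.of_isVariant (hv.resolvent hres hres' subset_rfl subset_rfl))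
    · refine ⟨rfl, ?_, hs, ?_, ?_⟩
      · simp only [List.map_append, List.map_map, Function.comp_def]
        congr 1
        · have : C''.body.map (fun l => (⟨l.subst θ', insert n anc⟩ : Subgoal L)) =
            (C''.body.map (Literal.subst θ')).map fun l => ⟨l, insert n anc⟩ := by simp
          rw [this, ← hb]; simp
        · refine List.map_congr_left fun s hs => ?_
          have := List.map_inj_left.1 hrest s.lit (List.mem_map_of_mem hs)
          simp [this]
      -- A new input variable occurs in some `θ x` with `x` an old one, and `(θ x).subst τ` is the
      -- ground term `σ x`.
      · intro y hy
        simp only [Set.mem_iUnion] at hy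
        obtain ⟨x, hx, hy⟩ := hy
        have h1 := hmg x
        rw [hτg x (hMi hx) (hgr x hx)] at h1
        exact ground_subst_iff.1 (by rw [h1]; exact hgr x hx) y hy
      · intro hsub1
        have := (hv hsub1).resolvent hr0 hr hMl hN.lits_subset
        simpa [Node.lits, LP.resolvent, Function.comp_def] using this
  | negArc n A' anc rest' used' inputs' sub' hA' =>
    obtain rfl : n = m := hd
    obtain ⟨⟨l, anc⟩, rest, rfl, hl, rfl⟩ := List.map_eq_cons_iff.1 hg.symm
    simp only [Subgoal.mk.injEq] at hl
    obtain ⟨hl, rfl⟩ := hl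
    cases l with
    | pos B => simp [Literal.subst] at hl
    | neg A =>
    simp only [Literal.subst, Literal.neg.injEq] at hl
    have hA := hfl A anc rest rfl
    rw [hA.subst] at hl
    subst hl
    refine ⟨_, _, σ, .negArc n A anc rest used inputs sub hA, ⟨rfl, ?_, Iff.rfl, hgr, fun _ => ?_⟩,
      fun _ _ _ => rfl, fun x => rfl⟩
    · simp [Literal.subst, hA.subst]
    · exact .refl _
  | negSuccess n A' anc rest' used' inputs' sub' hA' hout =>
    obtain rfl : n = m := hd
    obtain ⟨⟨l, anc⟩, rest, rfl, hl, rfl⟩ := List.map_eq_cons_iff.1 hg.symm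
    simp only [Subgoal.mk.injEq] at hl
    obtain ⟨hl, rfl⟩ := hl
    cases l with
    | pos B => simp [Literal.subst] at hl
    | neg A =>
    simp only [Literal.subst, Literal.neg.injEq] at hl
    have hA := hfl A anc rest rfl
    rw [hA.subst] at hl
    subst hl
    refine ⟨_, _, σ, .negSuccess n A anc rest used inputs sub hA hout,
      ⟨rfl, rfl, hs, hgr, fun hsub => ?_⟩, fun _ _ _ => rfl, fun x => rfl⟩
    have := hv hsub
    simp only [Node.lits, List.map_cons] at this
    exact this.tail

/-- Dependent choice along the natural numbers. -/
theorem exists_seq {α β : Type*} (R : ℕ → α → Prop) (T : ℕ → α → β → α → Prop) {a : α}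
    (h0 : R 0 a) (hs : ∀ n a, R n a → ∃ b a', T n a b a' ∧ R (n + 1) a') :
    ∃ (f : ℕ → α) (g : ℕ → β), f 0 = a ∧ ∀ n, R n (f n) ∧ T n (f n) (g n) (f (n + 1)) := by
  choose b a' hT hR using hs
  let F : (n : ℕ) → {x : α // R n x} := fun n =>
    Nat.rec ⟨a, h0⟩ (fun n x => ⟨a' n x.1 x.2, hR n x.1 x.2⟩) n
  exact ⟨fun n => (F n).1, fun n => b n (F n).1 (F n).2, rfl, fun n => ⟨(F n).2, hT n _ _⟩⟩

/-- An infinite derivation of an instance lifts to an infinite derivation without infinite chain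
of substitutions of input variables. -/
theorem InfDerivation.exists_lift {P : Program L} {root root' : Node L} {σ : Subst L}
    (D : InfDerivation P root') (h : Lifts root' root σ) (hroot : root.Proper)
    (hroot' : root'.Proper) (hfl : NonFloundering P root) :
    ∃ D' : InfDerivation P root, ¬ D'.HasInfiniteInputChain := by
  obtain ⟨f, g, hf0, hfg⟩ := exists_seq (α := Node L × Subst L) (β := Subst L) (a := (root, σ))
    (fun n a => Lifts (D.node n) a.1 a.2 ∧ a.1.Proper ∧ InTree P root a.1)
    (fun n a θ a' => Step P a.1 θ a'.1 ∧ (∀ x ∈ a.1.used, termVars (a.2 x) = ∅ → a'.2 x = a.2 x) ∧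
      ∀ x, (θ x).subst a'.2 = a'.2 x)
    ⟨by rw [D.node_zero]; exact h, hroot, .refl⟩ (by
      rintro n ⟨M, σ⟩ ⟨hl, hp, ht⟩
      obtain ⟨θ, M', σ', h1, h2, h3, h4⟩ := hl.exists_step (D.proper hroot' n) hp (hfl M ht) (D.step n)
      exact ⟨θ, (M', σ'), ⟨h1, h3, h4⟩, h2, h1.proper hp, ht.tail ⟨θ, h1⟩⟩)
  let D' : InfDerivation P root := ⟨fun n => (f n).1, g, by simp [hf0], fun n => (hfg n).2.1⟩
  refine ⟨D', ?_⟩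
  rintro ⟨k, Y, hk, hY0, hch⟩
  have hused : ∀ n, (f n).1.used ⊆ (f (n + 1)).1.used := fun n => (hfg n).2.1.used_subset
  have hstable : ∀ x n, x ∈ (f n).1.used → termVars ((f n).2 x) = ∅ → ∀ m, n ≤ m →
      x ∈ (f m).1.used ∧ (f m).2 x = (f n).2 x := by
    intro x n hx hg m hm
    induction m, hm using Nat.le_induction with
    | base => exact ⟨hx, rfl⟩
    | succ m hm ih =>
      refine ⟨hused m ih.1, ?_⟩
      rw [(hfg m).2.2.1 x ih.1 (by rw [ih.2]; exact hg), ih.2]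
  -- The ground value of `Y i` is an instance of a compound term containing `Y (i + 1)`, so the
  -- value of `Y (i + 1)` is strictly smaller. By `hstable` this value is still the same at the
  -- later time `k (i + 1)`.
  have hstep : ∀ i, Y i ∈ (f (k i)).1.used → termVars ((f (k i)).2 (Y i)) = ∅ →
      Y (i + 1) ∈ (f (k (i + 1))).1.used ∧ termVars ((f (k (i + 1))).2 (Y (i + 1))) = ∅ ∧
      termSize ((f (k (i + 1))).2 (Y (i + 1))) < termSize ((f (k i)).2 (Y i)) := by
    intro i hu hg
    obtain ⟨n, F, ts, hF, hYi⟩ := hch i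
    have hF : g (k i) (Y i) = Term.func F ts := hF
    have h1 := (hfg (k i)).2.2.1 _ hu hg
    have h2 := (hfg (k i)).2.2.2 (Y i)
    rw [h1, hF] at h2
    have hg' := ground_subst_iff.1 (by rw [h2]; exact hg) _ hYi
    have hlt := termSize_lt_subst_func (f (k i + 1)).2 hYi
    have hu' : Y (i + 1) ∈ (f (k i + 1)).1.used :=
      (hfg (k i)).2.1.termVars_subset (hfg (k i)).1.2.1 (hused _ hu) (by rw [hF]; exact hYi)
    obtain ⟨h3, h4⟩ := hstable _ _ hu' hg' _ (hk (Nat.lt_succ_self i))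
    rw [h4]
    exact ⟨h3, hg', by rwa [h2] at hlt⟩
  have hall : ∀ i, Y i ∈ (f (k i)).1.used ∧ termVars ((f (k i)).2 (Y i)) = ∅ := by
    intro i
    induction i with
    | zero =>
      exact ⟨(hfg (k 0)).1.2.1.inputs_subset hY0, (hfg (k 0)).1.1.ground _ hY0⟩
    | succ i ih => exact ⟨(hstep i ih.1 ih.2).1, (hstep i ih.1 ih.2).2.1⟩
  exact not_strictAnti_of_wellFoundedLT (fun i => termSize ((f (k i)).2 (Y i)))
    (strictAnti_nat_of_succ_lt fun i => (hstep i (hall i).1 (hall i).2).2.2)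

end Lifting

/-! ### Finite signatures and Higman's lemma -/

section Signature

open Classical in
/-- Replaces the maximal subterms whose leading symbol is not in `S` by a variable. -/
noncomputable def prune (S : Set (Σ n, L.Functions n)) : L.Term ℕ → L.Term ℕ
  | .var x => .var x
  | .func (l := n) f ts =>
    if (⟨n, f⟩ : Σ n, L.Functions n) ∈ S then .func f fun i => prune S (ts i) else .var 0

theorem termFuncs_prune (S : Set (Σ n, L.Functions n)) (t : L.Term ℕ) :
    termFuncs (prune S t) ⊆ S := by
  induction t with
  | var x => simp [prune]
  | func f ts ih =>
    rw [prune]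
    split_ifs with h
    · simpa [Set.insert_subset_iff, h] using ih
    · simp

theorem prune_subst {S : Set (Σ n, L.Functions n)} {t : L.Term ℕ} (h : termFuncs t ⊆ S)
    (σ : Subst L) : prune S (t.subst σ) = t.subst fun x => prune S (σ x) := by
  induction t with
  | var x => rfl
  | func f ts ih =>
    simp only [termFuncs_func, Set.insert_subset_iff, Set.iUnion_subset_iff] at h
    simp only [subst_func, prune, h.1, if_true]
    simp only [ih _ (h.2 _)]

/-- Pruning the values of a unifier gives a unifier again, because pruning commutes with
instantiating terms over `S`. -/
theorem Atom.subst_prune {S : Set (Σ n, L.Functions n)} {A H : Atom L} (hA : A.funcs ⊆ S)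
    (hH : H.funcs ⊆ S) {σ : Subst L} (h : A.subst σ = H.subst σ) :
    (A.subst fun x => prune S (σ x)) = H.subst fun x => prune S (σ x) := by
  have key : ∀ A : Atom L, A.funcs ⊆ S → (A.subst fun x => prune S (σ x)) =
      ⟨(A.subst σ).arity, (A.subst σ).pred, fun i => prune S ((A.subst σ).args i)⟩ := by
    intro A hA
    simp only [Atom.funcs, Set.iUnion_subset_iff] at hA
    simp [Atom.subst, prune_subst (hA _)]
  rw [key A hA, key H hH, h]

theorem Clause.funcs_rename (C : Clause L) (e : ℕ → ℕ) :
    (C.subst fun x => Term.var (e x)).funcs = C.funcs := by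
  ext f
  simp [Clause.funcs, Clause.subst, Atom.mem_funcs_subst]

/-- A most general unifier introduces no new function symbols. -/
theorem Resolves.termFuncs_subset {inputs used : Set ℕ} {A : Atom L} {C C' : Clause L}
    {θ : Subst L} {S : Set (Σ n, L.Functions n)} (h : Resolves inputs used A C C' θ)
    (hA : A.funcs ⊆ S) (hC : C.funcs ⊆ S) (x : ℕ) : termFuncs (θ x) ⊆ S := by
  obtain ⟨e, rfl⟩ := h.variant
  rw [← C.funcs_rename e] at hC
  -- Comparison with the pruned unifier gives `(θ x).subst (prune S ∘ θ) = prune S (θ x)`; the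
  -- symbols of `θ x` occur on the left, while the right side is over `S`.
  have := h.most_general _ (Atom.subst_prune hA (Set.subset_union_left.trans hC) h.unifies) x
  intro f hf
  exact termFuncs_prune S (θ x) (this ▸ mem_termFuncs_subst.2 (Or.inl hf))

/-- The function and predicate symbols of the goal at a node are in `S` and `R`. -/
def Node.InSignature (S : Set (Σ n, L.Functions n)) (R : Set (Σ n, L.Relations n)) (N : Node L) :
    Prop :=
  ∀ s ∈ N.goal, s.lit.atom.funcs ⊆ S ∧ s.lit.atom.predSymbol ∈ R

/-- The predicate symbols in the bodies of the clauses. -/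
def Program.bodyPreds (P : Program L) : Set (Σ n, L.Relations n) :=
  {p | ∃ C ∈ P, ∃ l ∈ C.body, l.atom.predSymbol = p}

theorem Program.finite_bodyPreds (P : Program L) : P.bodyPreds.Finite := by
  have : P.bodyPreds = ⋃ C ∈ {C | C ∈ P}, (fun l => l.atom.predSymbol) '' {l | l ∈ C.body} := by
    ext; simp [Program.bodyPreds]
  rw [this]
  exact (List.finite_toSet P).biUnion fun C _ => (List.finite_toSet C.body).image _

theorem Program.funcs_subset {P : Program L} {C : Clause L} (h : C ∈ P) : C.funcs ⊆ P.funcs :=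
  fun _ hf => ⟨C, h, hf⟩

theorem Step.termFuncs_subset {P : Program L} {N N' : Node L} {θ : Subst L}
    {S : Set (Σ n, L.Functions n)} {R : Set (Σ n, L.Relations n)} (h : Step P N θ N')
    (hS : P.funcs ⊆ S) (hN : N.InSignature S R) (x : ℕ) : termFuncs (θ x) ⊆ S := by
  cases h with
  | resolve n A anc rest used inputs sub k C C' θ hC hr hsub =>
    exact hr.termFuncs_subset (hN _ List.mem_cons_self).1
      ((Program.funcs_subset (List.mem_of_getElem? hC)).trans hS) x
  | negArc => simp [idSubst]
  | negSuccess => simp [idSubst]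

theorem Step.inSignature {P : Program L} {N N' : Node L} {θ : Subst L}
    {S : Set (Σ n, L.Functions n)} {R : Set (Σ n, L.Relations n)} (h : Step P N θ N')
    (hS : P.funcs ⊆ S) (hR : P.bodyPreds ⊆ R) (hN : N.InSignature S R) : N'.InSignature S R := by
  have hθ := h.termFuncs_subset hS hN
  cases h with
  | resolve n A anc rest used inputs sub k C C' θ hC hr hsub =>
    have hCP := List.mem_of_getElem? hC
    obtain ⟨e, hC'⟩ := hr.variant
    have hbody : ∀ l ∈ C'.body, l.atom.funcs ⊆ S ∧ l.atom.predSymbol ∈ R := by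
      intro l hl
      constructor
      · intro f hf
        exact hS (Program.funcs_subset hCP (C.funcs_rename e ▸ hC' ▸ Or.inr ⟨l, hl, hf⟩))
      · rw [hC'] at hl
        obtain ⟨l', hl', rfl⟩ := List.mem_map.1 hl
        exact hR ⟨C, hCP, l', hl', by simp⟩
    have hsubst : ∀ l : Literal L, l.atom.funcs ⊆ S → (l.subst θ).atom.funcs ⊆ S := by
      intro l hl f hf
      rw [Literal.atom_subst, Atom.mem_funcs_subst] at hf
      rcases hf with hf | ⟨x, -, hf⟩
      exacts [hl hf, hθ x hf]
    intro s hs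
    rcases List.mem_append.1 hs with hs | hs
    · obtain ⟨l, hl, rfl⟩ := List.mem_map.1 hs
      exact ⟨hsubst l (hbody l hl).1, by simpa using (hbody l hl).2⟩
    · obtain ⟨s', hs', rfl⟩ := List.mem_map.1 hs
      have := hN s' (List.mem_cons_of_mem _ hs')
      exact ⟨hsubst _ this.1, by simpa using this.2⟩
  | negArc n A anc rest used inputs sub hA =>
    intro s hs
    obtain rfl := List.mem_singleton.1 hs
    exact hN ⟨Literal.neg A, anc⟩ List.mem_cons_self
  | negSuccess => exact fun s hs => hN s (List.mem_cons_of_mem _ hs)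

theorem InfDerivation.inSignature {P : Program L} {root : Node L} (D : InfDerivation P root)
    {S : Set (Σ n, L.Functions n)} {R : Set (Σ n, L.Relations n)} (hS : P.funcs ⊆ S)
    (hR : P.bodyPreds ⊆ R) (h : root.InSignature S R) (n : ℕ) : (D.node n).InSignature S R := by
  induction n with
  | zero => rw [D.node_zero]; exact h
  | succ n ih => exact (D.step n).inSignature hS hR ih

theorem mem_termString {t : L.Term ℕ} {s : Sym L} (h : s ∈ termString t) :
    s = Sym.X ∨ ∃ f ∈ termFuncs t, s = Sym.func f := by
  induction t with
  | var x => simpa [termString] using h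
  | func f ts ih =>
    simp only [termString, List.mem_cons, List.mem_flatten, List.mem_ofFn,
      exists_exists_eq_and] at h
    rcases h with h | ⟨i, h⟩
    · exact Or.inr ⟨_, by simp, h⟩
    · refine (ih i h).imp_right ?_
      rintro ⟨g, hg, h⟩
      exact ⟨g, by simp only [termFuncs_func]; exact Or.inr (Set.mem_iUnion.2 ⟨i, hg⟩), h⟩

theorem Atom.exists_string (A : Atom L) : ∃ l, A.string = Sym.pred A.predSymbol :: l ∧
    ∀ s ∈ l, s = Sym.X ∨ ∃ f ∈ A.funcs, s = Sym.func f := by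
  refine ⟨_, rfl, fun s hs => ?_⟩
  simp only [List.mem_flatten, List.mem_ofFn, exists_exists_eq_and] at hs
  obtain ⟨i, hs⟩ := hs
  refine (mem_termString hs).imp_right ?_
  rintro ⟨f, hf, h⟩
  exact ⟨f, Set.mem_iUnion.2 ⟨i, hf⟩, h⟩

/-- A string contains a predicate symbol only at its head, so an embedding must match the two heads.
-/
theorem loopsInto_of_sublist {A B : Atom L} (h : List.Sublist A.string B.string) :
    LoopsInto A B := by
  refine ⟨?_, h⟩
  obtain ⟨l, hl, -⟩ := A.exists_string
  obtain ⟨l', hl', hmem⟩ := B.exists_string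
  rw [hl, hl'] at h
  have := h.subset List.mem_cons_self
  rcases List.mem_cons.1 this with h | h
  · simpa using h
  · rcases hmem _ h with h | ⟨f, -, h⟩ <;> cases h

/-- By Higman's lemma, a sequence of atoms over a finite signature has a subsequence in which every
atom loops into all later ones. -/
theorem exists_loopsInto_subseq {S : Set (Σ n, L.Functions n)} {R : Set (Σ n, L.Relations n)}
    (hS : S.Finite) (hR : R.Finite) {A : ℕ → Atom L}
    (hA : ∀ n, (A n).funcs ⊆ S ∧ (A n).predSymbol ∈ R) :
    ∃ g : ℕ → ℕ, StrictMono g ∧ ∀ i j, i ≤ j → LoopsInto (A (g i)) (A (g j)) := by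
  let T : Set (Sym L) := insert Sym.X (Sym.func '' S ∪ Sym.pred '' R)
  have hT : T.Finite := ((hS.image _).union (hR.image _)).insert _
  -- Higman's lemma over the finite alphabet `T`, on which equality is already a well partial order.
  have hpwo := Set.PartiallyWellOrderedOn.partiallyWellOrderedOn_sublistForall₂ Eq
    (s := T) hT.partiallyWellOrderedOn
  have : IsPreorder (List (Sym L)) (List.SublistForall₂ Eq) := { }
  obtain ⟨g, hg⟩ := hpwo.exists_monotone_subseq (f := fun n => (A n).string) (by
    intro n s hs
    obtain ⟨l, hl, hmem⟩ := (A n).exists_string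
    simp only [hl, List.mem_cons] at hs
    rcases hs with rfl | hs
    · exact Or.inr (Or.inr ⟨_, (hA n).2, rfl⟩)
    · rcases hmem s hs with rfl | ⟨f, hf, rfl⟩
      · exact Or.inl rfl
      · exact Or.inr (Or.inl ⟨f, (hA n).1 hf, rfl⟩))
  refine ⟨g, g.strictMono, fun i j hij => loopsInto_of_sublist ?_⟩
  obtain ⟨l, h1, h2⟩ := List.sublistForall₂_iff.1 (hg i j hij)
  rw [List.forall₂_eq_eq_eq] at h1
  exact h1 ▸ h2

end Signature

/-! ### Loop goals in every infinite derivation -/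

section LoopForm

variable {P : Program L} {root : Node L}

theorem InfDerivation.depth (D : InfDerivation P root) (h : root.depth = 0) (n : ℕ) :
    (D.node n).depth = n := by
  induction n with
  | zero => rw [D.node_zero, h]
  | succ n ih => rw [(D.step n).depth, ih]

/-- All subgoals at `N`, except for the last `m` ones, have the ancestor `d`. -/
def Node.Below (N : Node L) (d m : ℕ) : Prop :=
  ∃ top bottom, N.goal = top ++ bottom ∧ bottom.length = m ∧ ∀ s ∈ top, d ∈ s.anc

/-- The goal is a stack: a step acts on its top, and what it introduces inherits the ancestors of
the selected subgoal. Thus the ancestor `d` persists while the goal stays longer than its bottom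
part. -/
theorem Step.below {N N' : Node L} {θ : Subst L} {d m : ℕ} (h : Step P N θ N')
    (hN : N.Below d m) (hlen : m < N.goal.length) (hlen' : m < N'.goal.length) : N'.Below d m := by
  obtain ⟨top, bottom, hg, rfl, htop⟩ := hN
  cases top with
  | nil => simp [hg] at hlen
  | cons s top =>
  simp only [List.mem_cons, forall_eq_or_imp] at htop
  cases h with
  | resolve n A anc rest used inputs sub k C C' θ hC hr hsub =>
    simp only [List.cons_append, List.cons.injEq] at hg
    obtain ⟨rfl, rfl⟩ := hg
    refine ⟨C'.body.map (fun l => ⟨l.subst θ, insert n anc⟩) ++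
      top.map (fun s => ⟨s.lit.subst θ, s.anc⟩), bottom.map (fun s => ⟨s.lit.subst θ, s.anc⟩),
      by simp, by simp, ?_⟩
    intro s hs
    rcases List.mem_append.1 hs with hs | hs
    · obtain ⟨l, -, rfl⟩ := List.mem_map.1 hs
      exact Or.inr htop.1
    · obtain ⟨s', hs', rfl⟩ := List.mem_map.1 hs
      exact htop.2 s' hs'
  | negArc n A anc rest used inputs sub hA =>
    simp only [List.cons_append, List.cons.injEq] at hg
    obtain ⟨rfl, rfl⟩ := hg
    -- After a negation arc the goal has length one, so `hlen'` leaves no room for a bottom part.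
    have : bottom = [] := by simpa using hlen'
    subst this
    exact ⟨[⟨Literal.pos A, anc⟩], [], rfl, rfl, by simpa using htop.1⟩
  | negSuccess n A anc rest used inputs sub hA hout =>
    simp only [List.cons_append, List.cons.injEq] at hg
    obtain ⟨rfl, rfl⟩ := hg
    exact ⟨top, bottom, rfl, rfl, htop.2⟩

theorem Step.below_of_pos {N N' : Node L} {θ : Subst L} {A : Atom L} {anc : Set ℕ}
    {rest : List (Subgoal L)} (h : Step P N θ N') (hN : N.goal = ⟨Literal.pos A, anc⟩ :: rest) :
    N'.Below N.depth rest.length := by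
  cases h with
  | resolve n A' anc' rest' used inputs sub k C C' θ hC hr hsub =>
    simp only [List.cons.injEq] at hN
    obtain ⟨-, rfl⟩ := hN
    refine ⟨_, _, rfl, by simp, fun s hs => ?_⟩
    obtain ⟨l, -, rfl⟩ := List.mem_map.1 hs
    exact Set.mem_insert _ _
  | negArc => simp at hN
  | negSuccess => simp at hN

/-- Every infinite derivation over a finite signature contains an infinite sequence of loop
goals. -/
theorem InfDerivation.hasLoopForm (D : InfDerivation P root) (hd : root.depth = 0)
    {S : Set (Σ n, L.Functions n)} {R : Set (Σ n, L.Relations n)} (hS : P.funcs ⊆ S)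
    (hSf : S.Finite) (hR : P.bodyPreds ⊆ R) (hRf : R.Finite) (h : root.InSignature S R) :
    D.HasLoopForm := by
  -- The height of the stack at a good node is never undercut. A node of minimal height in any tail
  -- of the derivation is good.
  let good : ℕ → Prop := fun n =>
    ∀ n', n ≤ n' → (D.node n).goal.length ≤ (D.node n').goal.length
  have hgood : ∀ N, ∃ n, N ≤ n ∧ good n := by
    intro N
    obtain ⟨n, hn, hmin⟩ := WellFounded.has_min (measure fun n => (D.node n).goal.length).wf
      (Set.Ici N) ⟨N, Set.self_mem_Ici⟩
    exact ⟨n, hn, fun n' hn' => not_lt.1 (hmin n' (le_trans hn hn'))⟩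
  have hpos : ∀ N, ∃ n, N ≤ n ∧ good n ∧ ∃ A anc rest,
      (D.node n).goal = ⟨Literal.pos A, anc⟩ :: rest := by
    intro N
    obtain ⟨n, hn, hg⟩ := hgood N
    -- At a good node the step cannot delete a literal. If it is a negation arc, the target has the
    -- minimal height one and a positive selection, so the target serves instead.
    have hstep := D.step n
    generalize hM : D.node n = M at hstep
    generalize hM' : D.node (n + 1) = M' at hstep
    generalize D.mgu n = θ at hstep
    cases hstep with
    | resolve m A anc rest => exact ⟨n, hn, hg, A, anc, rest, by rw [hM]⟩
    | negArc m A anc rest =>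
      refine ⟨n + 1, by omega, fun n' hn' => ?_, A, anc, [], by rw [hM']⟩
      have := hg n' (by omega)
      simp only [hM, hM', List.length_cons, List.length_nil] at this ⊢
      omega
    | negSuccess m A anc rest =>
      have := hg (n + 1) (by omega)
      simp [hM, hM'] at this
  have hbelow : ∀ n, good n → ∀ A anc rest, (D.node n).goal = ⟨Literal.pos A, anc⟩ :: rest →
      ∀ n', n < n' → (D.node n').Below n rest.length := by
    intro n hg A anc rest hn n' hn'
    have hlen : ∀ k, n ≤ k → rest.length < (D.node k).goal.length := by
      intro k hk
      have := hg k hk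
      rw [hn, List.length_cons] at this
      omega
    induction n', hn' using Nat.le_induction with
    | base =>
      have := (D.step n).below_of_pos hn
      rwa [D.depth hd] at this
    | succ k hk ih => exact (D.step k).below ih (hlen k (by omega)) (hlen (k + 1) (by omega))
  obtain ⟨φ, hφ, hφg⟩ := Nat.exists_strictMono_subsequence
    (P := fun n => good n ∧ ∃ A anc rest, (D.node n).goal = ⟨Literal.pos A, anc⟩ :: rest)
    (fun N => let ⟨n, hn, h⟩ := hpos (N + 1); ⟨n, hn, h⟩)
  choose hφg A anc rest hA using hφg
  obtain ⟨g, hg, hloop⟩ := exists_loopsInto_subseq hSf hRf (A := A) fun n =>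
    D.inSignature hS hR h (φ n) ⟨Literal.pos (A n), anc n⟩ (by rw [hA]; exact List.mem_cons_self)
  refine ⟨φ ∘ g, hφ.comp hg, fun j => ⟨_, _, _, _, _, _, hA (g j), hA (g (j + 1)), ?_,
    hloop j (j + 1) (Nat.le_succ j)⟩⟩
  have hlt : φ (g j) < φ (g (j + 1)) := hφ (hg (Nat.lt_succ_self j))
  -- Goodness makes the later goal longer than its bottom part, so its selected subgoal lies in
  -- `top` and has the required ancestor.
  obtain ⟨top, bottom, hgoal, hlen, htop⟩ := hbelow _ (hφg (g j)) _ _ _ (hA (g j)) _ hlt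
  have hge := hφg (g j) _ hlt.le
  rw [hA (g j)] at hge
  cases top with
  | nil =>
    rw [hgoal] at hge
    simp [hlen] at hge
  | cons s top =>
    rw [hA, List.cons_append, List.cons.injEq] at hgoal
    rw [D.depth hd]
    have := htop s List.mem_cons_self
    rwa [← hgoal.1] at this

end LoopForm

/-! ### The life span of variables -/

section InputVariables

variable {P : Program L} {N N' : Node L} {θ : Subst L}

/-- `x` occurs in the goal at `N` or has not been used before. -/
def Node.Live (N : Node L) (x : ℕ) : Prop := x ∈ litVars N.lits ∨ x ∉ N.used

theorem Step.inputs_eq (h : Step P N θ N') : N'.inputs = ⋃ x ∈ N.inputs, termVars (θ x) := by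
  cases h <;> simp [idSubst]

theorem Step.input_var (h : Step P N θ N') {x y : ℕ} (hx : x ∈ N.inputs)
    (hy : θ x = Term.var y) : y ∈ N.inputs := by
  cases h with
  | resolve n A anc rest used inputs sub k C C' θ hC hr hsub => exact hr.input_var x hx y hy
  | negArc => cases hy; exact hx
  | negSuccess => cases hy; exact hx

theorem Step.idempotent (h : Step P N θ N') {x y : ℕ} (hy : y ∈ termVars (θ x)) :
    θ y = Term.var y := by
  cases h with
  | resolve n A anc rest used inputs sub k C C' θ hC hr hsub => exact hr.idempotent hy
  | negArc => rfl
  | negSuccess => rfl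

theorem Resolves.not_mem_used {inputs used : Set ℕ} {A : Atom L} {C C' : Clause L}
    (h : Resolves inputs used A C C' θ) {x : ℕ} (hx : x ∈ C'.vars) : x ∉ used :=
  Set.disjoint_left.1 h.fresh hx

theorem Step.live_of_ne (h : Step P N θ N') {x : ℕ} (hx : θ x ≠ Term.var x) :
    N.Live x ∧ ∀ y ∈ termVars (θ x), N.Live y := by
  cases h with
  | resolve n A anc rest used inputs sub k C C' θ hC hr hsub =>
    have key : ∀ y ∈ A.vars ∪ C'.head.vars,
        Node.Live ⟨n, ⟨Literal.pos A, anc⟩ :: rest, used, inputs, sub⟩ y := by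
      rintro y (hy | hy)
      · exact Or.inl (by simp [Node.lits, Literal.atom, hy])
      · exact Or.inr (hr.not_mem_used (Or.inl hy))
    exact ⟨key x (hr.relevant x hx).1, fun y hy => key y ((hr.relevant x hx).2 hy)⟩
  | negArc => exact absurd rfl hx
  | negSuccess => exact absurd rfl hx

theorem Step.eq_or_live (h : Step P N θ N') {x y : ℕ} (hy : y ∈ termVars (θ x)) :
    y = x ∨ N.Live y := by
  by_cases hx : θ x = Term.var x
  · rw [hx] at hy; exact Or.inl (by simpa using hy)
  · exact Or.inr ((h.live_of_ne hx).2 y hy)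

/-- Variables of the new goal come from the remaining subgoals or from the clause body, whose
variables are fresh. -/
theorem Step.exists_live (h : Step P N θ N') {y : ℕ} (hy : y ∈ litVars N'.lits) :
    ∃ x, N.Live x ∧ y ∈ termVars (θ x) := by
  cases h with
  | resolve n A anc rest used inputs sub k C C' θ hC hr hsub =>
    obtain ⟨l, hl, hy⟩ := hy
    simp only [Node.lits, List.map_append, List.map_map, List.mem_append, List.mem_map,
      Function.comp_apply] at hl
    rcases hl with ⟨l, hl, rfl⟩ | ⟨s, hs, rfl⟩ <;>
      obtain ⟨x, hx, hy⟩ := Atom.mem_vars_subst.1 (Literal.atom_subst _ _ ▸ hy)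
    · exact ⟨x, Or.inr (hr.not_mem_used (Or.inr ⟨l, hl, hx⟩)), hy⟩
    · exact ⟨x, Or.inl ⟨s.lit, List.mem_map_of_mem (List.mem_cons_of_mem _ hs), hx⟩, hy⟩
  | negArc n A anc rest used inputs sub hA =>
    have : A.vars = ∅ := hA
    simp [Node.lits, Literal.atom, this] at hy
  | negSuccess n A anc rest used inputs sub hA hout =>
    exact ⟨y, Or.inl (by simp [Node.lits] at hy ⊢; exact Or.inr hy), by simp [idSubst]⟩

theorem Step.live (h : Step P N θ N') {y : ℕ} (hy : y ∈ litVars N'.lits) : N.Live y := by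
  obtain ⟨x, hx, hy⟩ := h.exists_live hy
  exact (h.eq_or_live hy).elim (fun h => h ▸ hx) id

/-- `x` has been used before, but no longer occurs in the goal nor among the input variables. -/
def Node.Dead (N : Node L) (x : ℕ) : Prop := ¬ N.Live x ∧ x ∉ N.inputs

/-- Unifiers touch only goal variables and fresh clause variables, so a dead variable cannot return.
-/
theorem Step.dead (h : Step P N θ N') {x : ℕ} (hx : N.Dead x) : N'.Dead x := by
  refine ⟨fun hl => hl.elim (fun hl => hx.1 (h.live hl)) fun hl => hx.1 (Or.inr fun hu =>
    hl (h.used_subset hu)), fun hi => ?_⟩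
  rw [h.inputs_eq] at hi
  simp only [Set.mem_iUnion] at hi
  obtain ⟨z, hz, hxz⟩ := hi
  rcases h.eq_or_live hxz with rfl | hl
  exacts [hx.2 hz, hx.1 hl]

/-- By idempotence a replaced variable occurs in no image, hence neither in the new goal nor among
the new input variables. -/
theorem Step.dead_of_ne (h : Step P N θ N') {x : ℕ} (hu : x ∈ N.used) (hx : θ x ≠ Term.var x) :
    N'.Dead x := by
  refine ⟨fun hl => hl.elim (fun hl => ?_) fun hl => hl (h.used_subset hu), fun hi => ?_⟩
  · obtain ⟨z, -, hz⟩ := h.exists_live hl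
    exact hx (h.idempotent hz)
  · rw [h.inputs_eq] at hi
    simp only [Set.mem_iUnion] at hi
    obtain ⟨z, -, hz⟩ := hi
    exact hx (h.idempotent hz)

/-- In subsidiary trees, the goal contains no input variables. -/
def Node.Separated (N : Node L) : Prop := N.subsidiary → ∀ x ∈ N.inputs, x ∉ litVars N.lits

/-- A negation arc leads to a ground goal. From there on an input variable is used but absent from
the goal, so it is neither moved nor reintroduced. -/
theorem Step.separated (h : Step P N θ N') (hN : N.Proper) (hs : N.Separated) :
    N'.Separated := by
  have key : N.subsidiary → ∀ x ∈ N'.inputs, x ∉ litVars N'.lits := by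
    intro hsub y hy hl
    have hdead : ∀ x ∈ N.inputs, ¬ N.Live x := fun x hx h =>
      h.elim (hs hsub x hx) fun h => h (hN.inputs_subset hx)
    rw [h.inputs_eq] at hy
    simp only [Set.mem_iUnion] at hy
    obtain ⟨x, hx, hy⟩ := hy
    have hx' : θ x = Term.var x := by
      by_contra hne
      exact hdead x hx (h.live_of_ne hne).1
    rw [hx'] at hy
    obtain rfl : y = x := by simpa using hy
    exact hdead y hx (h.live hl)
  cases h with
  | resolve => exact key
  | negArc n A anc rest used inputs sub hA =>
    intro _ x _ hx
    have : A.vars = ∅ := hA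
    simp [Node.lits, Literal.atom, this] at hx
  | negSuccess => exact key

end InputVariables

/-! ### Stabilization of the input variables -/

section Limits

variable {P : Program L} {root : Node L}

/-- Consequently each input variable is replaced at most once along `D`. -/
theorem InfDerivation.dead_of_ne (D : InfDerivation P root) (hroot : root.Proper) {n x : ℕ}
    (hx : x ∈ (D.node n).inputs) (hne : D.mgu n x ≠ Term.var x) {m : ℕ} (hm : n < m) :
    x ∉ (D.node m).inputs := by
  have : (D.node m).Dead x := by
    induction m, hm using Nat.le_induction with
    | base => exact (D.step n).dead_of_ne ((D.proper hroot n).inputs_subset hx) hne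
    | succ m hm ih => exact (D.step m).dead ih
  exact this.2

/-- The input variable `y` occurs in the compound term that is substituted for the input
variable `x`. -/
def InfDerivation.Child (D : InfDerivation P root) (y x : ℕ) : Prop :=
  ∃ n, x ∈ (D.node n).inputs ∧
    (∃ (m : ℕ) (f : L.Functions m) (ts : Fin m → L.Term ℕ), D.mgu n x = Term.func f ts) ∧
    y ∈ termVars (D.mgu n x)

theorem InfDerivation.wellFounded_child (D : InfDerivation P root) (hroot : root.Proper)
    (hD : ¬ D.HasInfiniteInputChain) : WellFounded D.Child := by
  rw [wellFounded_iff_isEmpty_descending_chain]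
  refine ⟨fun ⟨Y, hY⟩ => hD ?_⟩
  choose k hk hf hm using hY
  refine ⟨k, Y, strictMono_nat_of_lt_succ fun i => ?_, hk 0, fun i => ?_⟩
  -- If `Y (i + 1)` were replaced no later than `Y i`, it would be dead by step `k i + 1`, yet it is
  -- an input variable there.
  · by_contra hlt
    obtain ⟨m, f, ts, h⟩ := hf (i + 1)
    refine D.dead_of_ne hroot (hk (i + 1)) (by simp [h]) (m := k i + 1) (by omega) ?_
    rw [(D.step (k i)).inputs_eq]
    simp only [Set.mem_iUnion]
    exact ⟨Y i, hk i, hm i⟩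
  · obtain ⟨m, f, ts, h⟩ := hf i
    exact ⟨m, f, ts, h, h ▸ hm i⟩

theorem InfDerivation.finite_child (D : InfDerivation P root) (hroot : root.Proper) (x : ℕ) :
    {y | D.Child y x}.Finite := by
  by_cases h : ∃ n, x ∈ (D.node n).inputs ∧ D.mgu n x ≠ Term.var x
  · obtain ⟨n, hx, hne⟩ := h
    refine (finite_termVars (D.mgu n x)).subset ?_
    rintro y ⟨m, hm, ⟨l, f, ts, hf⟩, hy⟩
    have hne' : D.mgu m x ≠ Term.var x := by simp [hf]
    have h1 : ¬ n < m := fun h => D.dead_of_ne hroot hx hne h hm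
    have h2 : ¬ m < n := fun h => D.dead_of_ne hroot hm hne' h hx
    obtain rfl : m = n := by omega
    exact hy
  · convert Set.finite_empty
    rw [Set.eq_empty_iff_forall_notMem]
    rintro y ⟨m, hm, ⟨l, f, ts, hf⟩, -⟩
    exact h ⟨m, hm, by simp [hf]⟩

/-- König's lemma in the form of well-founded induction: the child relation is finitely branching
and has no infinite descent, and all input variables descend from the finitely many at the root. -/
theorem InfDerivation.finite_inputs (D : InfDerivation P root) (hroot : root.Proper)
    (hD : ¬ D.HasInfiniteInputChain) : {x | ∃ n, x ∈ (D.node n).inputs}.Finite := by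
  have hdesc : ∀ x, {y | Relation.ReflTransGen (fun a b => D.Child b a) x y}.Finite := by
    intro x
    induction x using (D.wellFounded_child hroot hD).induction with
    | _ x ih =>
    refine (((D.finite_child hroot x).biUnion fun y hy => ih y hy).insert x).subset ?_
    intro y hy
    rcases Relation.ReflTransGen.cases_head hy with rfl | ⟨z, hz, hzy⟩
    · exact Or.inl rfl
    · exact Or.inr (Set.mem_biUnion (show z ∈ {y | D.Child y x} from hz) hzy)
  have h0 : (D.node 0).inputs.Finite :=
    (D.proper hroot 0).finite.subset (D.proper hroot 0).inputs_subset
  refine (h0.biUnion fun x _ => hdesc x).subset ?_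
  rintro y ⟨n, hy⟩
  simp only [Set.mem_iUnion, Set.mem_ofPred_eq]
  induction n generalizing y with
  | zero => exact ⟨y, hy, .refl⟩
  | succ n ih =>
    rw [(D.step n).inputs_eq] at hy
    simp only [Set.mem_iUnion] at hy
    obtain ⟨z, hz, hy⟩ := hy
    cases hθ : D.mgu n z with
    -- A variable replacing an input variable is already an input variable, so renaming creates
    -- nothing new.
    | var w =>
      rw [hθ] at hy
      obtain rfl : y = w := by simpa using hy
      exact ih ((D.step n).input_var hz hθ)
    | func f ts =>
      obtain ⟨x, hx, hxz⟩ := ih hz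
      exact ⟨x, hx, hxz.tail ⟨n, hz, ⟨_, f, ts, hθ⟩, hy⟩⟩

/-- Without infinite chains of substitutions, the input variables are eventually constant. -/
theorem InfDerivation.eventually_inputs (D : InfDerivation P root) (hroot : root.Proper)
    (hD : ¬ D.HasInfiniteInputChain) :
    ∃ M, ∀ n, M ≤ n → ∀ x ∈ (D.node n).inputs, D.mgu n x = Term.var x := by
  have h : ∀ᶠ n in Filter.atTop, ∀ x ∈ {x | ∃ n, x ∈ (D.node n).inputs},
      x ∈ (D.node n).inputs → D.mgu n x = Term.var x := by
    rw [Filter.eventually_all_finite (D.finite_inputs hroot hD)]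
    intro x _
    by_cases h : ∃ n, x ∈ (D.node n).inputs ∧ D.mgu n x ≠ Term.var x
    · obtain ⟨n, hx, hne⟩ := h
      filter_upwards [Filter.eventually_gt_atTop n] with m hm hxm
      exact absurd hxm (D.dead_of_ne hroot hx hne hm)
    · push Not at h
      exact Filter.Eventually.of_forall h
  obtain ⟨M, hM⟩ := Filter.eventually_atTop.1 h
  exact ⟨M, fun n hn x hx => hM n hn x ⟨n, hx⟩ hx⟩

/-- Ground terms that the input variables stand for in the limit. -/
theorem InfDerivation.exists_limit (D : InfDerivation P root) (hroot : root.Proper)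
    (hD : ¬ D.HasInfiniteInputChain) {S : Set (Σ n, L.Functions n)}
    (hS : ∀ n x, termFuncs (D.mgu n x) ⊆ S) {t : L.Term ℕ} (ht : termVars t = ∅)
    (htS : termFuncs t ⊆ S) :
    ∃ s : ℕ → Subst L, (∀ n, ∀ x ∈ (D.node n).inputs, s n x = (D.mgu n x).subst (s (n + 1))) ∧
      (∀ n x, termVars (s n x) = ∅) ∧ ∀ n x, termFuncs (s n x) ⊆ S := by
  obtain ⟨M, hM⟩ := D.eventually_inputs hroot hD
  -- Backward recursion: `F k` gives the values at time `M - k`. From time `M` on, truncated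
  -- subtraction yields `F 0`, the constant `t`.
  let F : ℕ → Subst L := fun k =>
    Nat.rec (fun _ => t) (fun k σ x => (D.mgu (M - (k + 1)) x).subst σ) k
  refine ⟨fun n => F (M - n), fun n x hx => ?_, fun n => ?_, fun n => ?_⟩ <;> beta_reduce
  · rcases le_or_gt M n with h | h
    · simp [hM n h x hx, Nat.sub_eq_zero_of_le h, Nat.sub_eq_zero_of_le (Nat.le_succ_of_le h), F]
    · obtain ⟨k, hk⟩ : ∃ k, M - n = k + 1 := ⟨M - n - 1, by omega⟩
      have h1 : M - (n + 1) = k := by omega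
      have h2 : M - (k + 1) = n := by omega
      simp only [hk, h1]
      change (D.mgu (M - (k + 1)) x).subst (F k) = _
      rw [h2]
  · generalize M - n = k
    induction k with
    | zero => exact fun _ => ht
    | succ k ih => exact fun x => ground_subst_iff.2 fun y _ => ih y
  · generalize M - n = k
    induction k with
    | zero => exact fun _ => htS
    | succ k ih =>
      intro x f hf
      rcases mem_termFuncs_subst.1 hf with hf | ⟨y, -, hf⟩
      exacts [hS _ _ hf, ih y hf]

end Limits

/-! ### Replacing input variables by ground terms in a derivation -/

section Instantiation

open Classical in
/-- The restriction of `s` to the variables in `X`. -/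
noncomputable def mask (X : Set ℕ) (s : Subst L) : Subst L :=
  fun x => if x ∈ X then s x else Term.var x

theorem mask_of_mem {X : Set ℕ} {s : Subst L} {x : ℕ} (h : x ∈ X) : mask X s x = s x := if_pos h

theorem mask_of_notMem {X : Set ℕ} {s : Subst L} {x : ℕ} (h : x ∉ X) :
    mask X s x = Term.var x := if_neg h

/-- Replacing the input variables by ground terms preserves resolution steps that are compatible
with these terms. -/
theorem Resolves.instantiate {inputs used used' : Set ℕ} {A : Atom L} {C C' : Clause L}
    {θ s s' : Subst L} (h : Resolves inputs used A C C' θ) (hin : inputs ⊆ used)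
    (hused : used' ⊆ used) (hs : ∀ x ∈ inputs, s x = (θ x).subst s')
    (hg : ∀ x, termVars (s x) = ∅) (hg' : ∀ x, termVars (s' x) = ∅) :
    ∃ θ' : Subst L, Resolves ∅ used' (A.subst (mask inputs s)) C C' θ' ∧
      ∀ x, (mask inputs s x).subst θ' =
        (θ x).subst (mask (⋃ x ∈ inputs, termVars (θ x)) s') := by
  classical
  set inputs' := ⋃ x ∈ inputs, termVars (θ x) with hinputs'
  have hin' : ∀ x ∈ inputs, ∀ y ∈ termVars (θ x), y ∈ inputs' := fun x hx y hy => by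
    simp only [hinputs', Set.mem_iUnion]; exact ⟨x, hx, hy⟩
  -- The input variables have vanished from the instance and must stay fixed for `θ'` to be
  -- relevant; elsewhere `θ'` is `θ` followed by the new ground values.
  let θ' : Subst L := fun x => if x ∈ inputs then Term.var x else (θ x).subst (mask inputs' s')
  have hθ'in : ∀ x ∈ inputs, θ' x = Term.var x := fun x hx => if_pos hx
  have hθ'out : ∀ x, x ∉ inputs → θ' x = (θ x).subst (mask inputs' s') := fun x hx => if_neg hx
  have hkey : ∀ x, (mask inputs s x).subst θ' = (θ x).subst (mask inputs' s') := by
    intro x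
    by_cases hx : x ∈ inputs
    · rw [mask_of_mem hx, subst_of_ground (hg x), hs x hx]
      exact subst_congr fun y hy => (mask_of_mem (hin' x hx y hy)).symm
    · rw [mask_of_notMem hx, subst_var, hθ'out x hx]
  have hC'in : ∀ x ∈ C'.vars, x ∉ inputs := fun x hx hi =>
    Set.disjoint_left.1 h.fresh hx (hin hi)
  have hhead : C'.head.subst (mask inputs s) = C'.head :=
    Atom.subst_eq_self fun x hx => mask_of_notMem (hC'in x (Or.inl hx))
  have hAvars : ∀ y, y ∈ (A.subst (mask inputs s)).vars ↔ y ∈ A.vars ∧ y ∉ inputs := by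
    intro y
    rw [Atom.mem_vars_subst]
    constructor
    · rintro ⟨x, hx, hy⟩
      by_cases hxi : x ∈ inputs
      · rw [mask_of_mem hxi, hg] at hy; exact hy.elim
      · rw [mask_of_notMem hxi] at hy
        obtain rfl : y = x := by simpa using hy
        exact ⟨hx, hxi⟩
    · rintro ⟨hy, hyi⟩
      exact ⟨y, hy, by simp [mask_of_notMem hyi]⟩
  have hidem : ∀ x, ∀ y ∈ termVars (θ x), y ∉ inputs' → y ∉ inputs := by
    intro x y hy hyi hy'
    exact hyi (hin' y hy' y (by simp [h.idempotent hy]))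
  have hmem : ∀ x, x ∉ inputs → x ∈ A.vars ∪ C'.head.vars →
      x ∈ (A.subst (mask inputs s)).vars ∪ C'.head.vars := fun x hx hxA =>
    hxA.imp_left fun h => (hAvars x).2 ⟨h, hx⟩
  have hvarsθ' : ∀ x, x ∉ inputs → ∀ y ∈ termVars (θ' x), y ∈ termVars (θ x) ∧ y ∉ inputs' := by
    intro x hx y hy
    rw [hθ'out x hx, mem_termVars_subst] at hy
    obtain ⟨z, hz, hy⟩ := hy
    by_cases hzi : z ∈ inputs'
    · rw [mask_of_mem hzi, hg'] at hy; exact hy.elim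
    · rw [mask_of_notMem hzi] at hy
      obtain rfl : y = z := by simpa using hy
      exact ⟨hz, hzi⟩
  refine ⟨θ', ⟨h.variant, h.fresh.mono_right hused, ?_, ?_, ?_, ?_, by simp⟩, hkey⟩
  · conv_rhs => rw [← hhead]
    simp only [Atom.subst_subst, hkey]
    rw [← Atom.subst_subst, ← Atom.subst_subst, h.unifies]
  · intro σ hσ x
    -- A unifier `σ` of the instance, preceded by the ground values, unifies the original atoms and
    -- so factors through `θ`.
    let τ : Subst L := fun x => (mask inputs s x).subst σ
    have hτin : ∀ x ∈ inputs, τ x = s x := fun x hx => by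
      simp only [τ, mask_of_mem hx, subst_of_ground (hg x)]
    have hτout : ∀ x, x ∉ inputs → τ x = σ x := fun x hx => by
      simp only [τ, mask_of_notMem hx, subst_var]
    have hτ : A.subst τ = C'.head.subst τ := by
      rwa [← hhead, Atom.subst_subst, Atom.subst_subst] at hσ
    have hmg := h.most_general τ hτ
    by_cases hx : x ∈ inputs
    · rw [hθ'in x hx, subst_var]
    · rw [hθ'out x hx, ← hτout x hx, ← hmg x, subst_subst]
      refine subst_congr fun y hy => ?_
      by_cases hyi : y ∈ inputs'
      · rw [mask_of_mem hyi, subst_of_ground (hg' y)]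
        simp only [hinputs', Set.mem_iUnion] at hyi
        obtain ⟨z, hz, hyz⟩ := hyi
        have := hmg z
        rw [hτin z hz, hs z hz] at this
        exact (subst_congr_iff.1 this y hyz).symm
      · rw [mask_of_notMem hyi, subst_var, hτout y (hidem x y hy hyi)]
  · intro x hx
    have hxi : x ∉ inputs := fun hxi => hx (hθ'in x hxi)
    have hdom : x ∈ A.vars ∪ C'.head.vars := by
      by_cases hne : θ x = Term.var x
      · by_cases hxi' : x ∈ inputs'
        · simp only [hinputs', Set.mem_iUnion] at hxi'
          obtain ⟨z, hz, hxz⟩ := hxi'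
          -- Here `θ` fixes `x`, but `x` has become an input variable by occurring in the
          -- replacement of `z`; relevance at `z` then locates `x`.
          have hz' : θ z ≠ Term.var z := fun hz' => by
            rw [hz'] at hxz
            obtain rfl : x = z := by simpa using hxz
            exact hxi hz
          exact (h.relevant z hz').2 hxz
        · refine absurd ?_ hx
          rw [hθ'out x hxi, hne, subst_var, mask_of_notMem hxi']
      · exact (h.relevant x hne).1
    refine ⟨hmem x hxi hdom, fun y hy => ?_⟩
    obtain ⟨hy1, hy2⟩ := hvarsθ' x hxi y hy
    refine hmem y (hidem x y hy1 hy2) ?_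
    rcases h.termVars_subset x hy1 with rfl | hy3
    exacts [hdom, hy3]
  · intro x hx y hxy
    obtain ⟨hxA, hxi⟩ := (hAvars x).1 hx
    obtain ⟨hy1, hy2⟩ := hvarsθ' x hxi y (by simp [hxy])
    refine (hAvars y).2 ⟨?_, hidem x y hy1 hy2⟩
    rw [hθ'out x hxi] at hxy
    cases hθx : θ x with
    | var w =>
      rw [hθx] at hy1
      obtain rfl : y = w := by simpa using hy1
      exact h.goal_var x hxA y hθx
    | func f ts => simp [hθx] at hxy

/-- The node obtained by replacing the input variables by terms. -/
noncomputable def Node.instantiate (N : Node L) (s : Subst L) (used : Set ℕ) : Node L :=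
  ⟨N.depth, N.goal.map fun t => ⟨t.lit.subst (mask N.inputs s), t.anc⟩, used, ∅, N.subsidiary⟩

/-- `s` and `s'` are the values of the input variables before and after the step. A smaller set of
used variables is allowed because it only weakens standardizing apart. -/
theorem Step.instantiate {P : Program L} {N N' : Node L} {θ s s' : Subst L} {used : Set ℕ}
    (h : Step P N θ N') (hN : N.Proper) (hsep : N.Separated) (hused : used ⊆ N.used)
    (hs : ∀ x ∈ N.inputs, s x = (θ x).subst s') (hg : ∀ x, termVars (s x) = ∅)
    (hg' : ∀ x, termVars (s' x) = ∅) :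
    ∃ θ' used', Step P (N.instantiate s used) θ' (N'.instantiate s' used') ∧ used' ⊆ N'.used := by
  cases h with
  | resolve n A anc rest used0 inputs sub k C C' θ hC hr hsub =>
    obtain ⟨θ', hr', hkey⟩ := hr.instantiate hN.inputs_subset hused hs hg hg'
    refine ⟨θ', used ∪ C'.vars, ?_, Set.union_subset_union_left _ hused⟩
    -- In a subsidiary tree the goal contains no input variables, so the instance is the goal itself
    -- and the stopping condition carries over verbatim.
    have hgoal : sub → A.subst (mask inputs s) = A ∧
        (rest.map fun t => (⟨t.lit.subst (mask inputs s), t.anc⟩ : Subgoal L)).map Subgoal.lit =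
          rest.map Subgoal.lit := by
      intro hsub1
      have hm : ∀ x ∈ litVars (Literal.pos A :: rest.map Subgoal.lit),
          mask inputs s x = Term.var x := fun x hx =>
        mask_of_notMem fun hxi => hsep hsub1 x hxi (by simpa [Node.lits] using hx)
      refine ⟨Atom.subst_eq_self fun x hx => hm x (by simp [Literal.atom, hx]), ?_⟩
      rw [List.map_map]
      exact List.map_congr_left fun t ht => Literal.subst_eq_self fun x hx =>
        hm x ⟨t.lit, List.mem_cons_of_mem _ (List.mem_map_of_mem ht), hx⟩
    have hstep := Step.resolve n (A.subst (mask inputs s)) anc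
      (rest.map fun t => ⟨t.lit.subst (mask inputs s), t.anc⟩) used ∅ sub k C C' θ' hC hr'
      (fun hsub1 => by
        rw [(hgoal hsub1).1, (hgoal hsub1).2]
        exact hsub hsub1)
    refine (congrArg (Step P _ θ') ?_).mpr hstep
    simp only [Node.instantiate, List.map_append, List.map_map, Node.mk.injEq, true_and,
      Set.mem_empty_iff_false, Set.iUnion_of_empty, Set.iUnion_empty, and_true]
    congr 1
    · refine List.map_congr_left fun l hl => ?_
      simp only [Function.comp_apply, Subgoal.mk.injEq, and_true]
      rw [Literal.subst_subst]
      refine Literal.subst_congr fun x hx => ?_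
      rw [← hkey, mask_of_notMem, subst_var]
      exact fun hxi => hr.not_mem_used (Or.inr ⟨l, hl, hx⟩) (hN.inputs_subset hxi)
    · refine List.map_congr_left fun t ht => ?_
      simp only [Function.comp_apply, Subgoal.mk.injEq, and_true]
      simp only [Literal.subst_subst, hkey]
  | negArc n A anc rest used0 inputs sub hA =>
    refine ⟨idSubst L, used, ?_, hused⟩
    simp only [Node.instantiate, List.map_cons, List.map_nil, Literal.subst, hA.subst]
    exact .negArc n A anc _ used ∅ sub hA
  | negSuccess n A anc rest used0 inputs sub hA hout =>
    have hmask : mask inputs s = mask inputs s' := by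
      funext x
      by_cases hx : x ∈ inputs
      · rw [mask_of_mem hx, mask_of_mem hx, hs x hx]; rfl
      · rw [mask_of_notMem hx, mask_of_notMem hx]
    refine ⟨idSubst L, used, ?_, hused⟩
    simp only [Node.instantiate, List.map_cons, Literal.subst, hA.subst, hmask]
    exact .negSuccess n A anc _ used ∅ sub hA hout

/-- An infinite derivation without infinite chain of substitutions of input variables has an
instance in which ground terms replace the input variables. -/
theorem InfDerivation.exists_instantiate {P : Program L} {root : Node L}
    (D : InfDerivation P root) (hroot : root.Proper) (hsep : root.Separated)
    (hD : ¬ D.HasInfiniteInputChain) {S : Set (Σ n, L.Functions n)}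
    (hS : ∀ n x, termFuncs (D.mgu n x) ⊆ S) {t : L.Term ℕ} (ht : termVars t = ∅)
    (htS : termFuncs t ⊆ S) :
    ∃ s : Subst L, (∀ x, termVars (s x) = ∅) ∧ (∀ x, termFuncs (s x) ⊆ S) ∧
      ∀ used ⊆ root.used, Nonempty (InfDerivation P (root.instantiate s used)) := by
  obtain ⟨s, hs, hg, hf⟩ := D.exists_limit hroot hD hS ht htS
  refine ⟨s 0, hg 0, hf 0, fun used hused => ?_⟩
  have hsepn : ∀ n, (D.node n).Separated := by
    intro n
    induction n with
    | zero => rw [D.node_zero]; exact hsep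
    | succ n ih => exact (D.step n).separated (D.proper hroot n) ih
  obtain ⟨U, g, hU0, hU⟩ := exists_seq (α := Set ℕ) (β := Subst L) (a := used)
    (fun n U => U ⊆ (D.node n).used)
    (fun n U θ U' => Step P ((D.node n).instantiate (s n) U) θ
      ((D.node (n + 1)).instantiate (s (n + 1)) U'))
    (by rw [D.node_zero]; exact hused) (by
      intro n U hU
      obtain ⟨θ', U', h1, h2⟩ := (D.step n).instantiate (D.proper hroot n) (hsepn n) hU (hs n)
        (hg n) (hg (n + 1))
      exact ⟨θ', U', h1, h2⟩)
  exact ⟨⟨fun n => (D.node n).instantiate (s n) (U n), g, by simp [hU0, D.node_zero],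
    fun n => (hU n).2⟩⟩

end Instantiation

/-! ### Roots of the moded tree and of the forest -/

namespace ModedQuery

theorem finite_funcs (Q : ModedQuery L) : Q.funcs.Finite := by
  have : Q.funcs = ⋃ i, ⋃ T ∈ {T | Q.args i = some T}, termFuncs T := by
    ext f; simp [funcs]
  rw [this]
  refine Set.finite_iUnion fun i => Set.Finite.biUnion ?_ fun T _ => finite_termFuncs T
  exact Set.Subsingleton.finite fun T hT T' hT' => Option.some.inj (hT.symm.trans hT')

/-- Substituting ground terms for the input variables of a moded query instantiates its input
modes. -/
theorem inst_var_subst (Q : ModedQuery L) {I : Fin Q.arity → ℕ} {σ : Subst L}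
    {t : Fin Q.arity → L.Term ℕ} (hI : ∀ i, Q.args i = none → σ (I i) = t i)
    (hT : ∀ i T, Q.args i = some T → ∀ x ∈ termVars T, σ x = Term.var x) :
    (Q.inst fun i => Term.var (I i)).subst σ = Q.inst t := by
  simp only [inst, Atom.subst, Atom.mk.injEq, heq_eq_eq, true_and]
  funext i
  cases h : Q.args i with
  | none => simpa using hI i h
  | some T => simpa using subst_eq_self (hT i T h)

theorem finite_inputs (Q : ModedQuery L) (I : Fin Q.arity → ℕ) :
    {x | ∃ i, Q.args i = none ∧ x = I i}.Finite :=
  (Set.finite_range I).subset (by rintro _ ⟨i, -, rfl⟩; exact ⟨i, rfl⟩)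

theorem modedRoot_proper (Q : ModedQuery L) (I : Fin Q.arity → ℕ) : (Q.modedRoot I).Proper :=
  rootNode_proper _ (Q.finite_inputs I)

theorem modedRoot_inSignature (Q : ModedQuery L) (I : Fin Q.arity → ℕ) :
    (Q.modedRoot I).InSignature Q.funcs {⟨Q.arity, Q.pred⟩} := by
  intro s hs
  obtain rfl := List.mem_singleton.1 hs
  refine ⟨fun f hf => ?_, rfl⟩
  obtain ⟨i, hf⟩ := Set.mem_iUnion.1 hf
  change f ∈ termFuncs ((Q.args i).getD (Term.var (I i))) at hf
  cases h : Q.args i with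
  | none => simp [h] at hf
  | some T => exact ⟨i, T, h, by simpa [h] using hf⟩

/-- The trees of the moded-query forest are instances of the moded tree. -/
theorem exists_lifts (Q : ModedQuery L) {I : Fin Q.arity → ℕ} (hI : Q.IsInputVars I)
    {t : Fin Q.arity → L.Term ℕ} (ht : ∀ i, Q.args i = none → termVars (t i) = ∅) :
    ∃ σ, Lifts (rootNode (Q.inst t) ∅) (Q.modedRoot I) σ := by
  classical
  let σ : Subst L := fun x =>
    if h : ∃ i, Q.args i = none ∧ x = I i then t h.choose else Term.var x
  have hσ : ∀ i, Q.args i = none → σ (I i) = t i := by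
    intro i hi
    have h : ∃ j, Q.args j = none ∧ I i = I j := ⟨i, hi, rfl⟩
    simp only [σ, dif_pos h]
    rw [← hI.1 i _ hi h.choose_spec.1 h.choose_spec.2]
  have hσ' : ∀ i T, Q.args i = some T → ∀ x ∈ termVars T, σ x = Term.var x := by
    intro i T hT x hx
    refine dif_neg ?_
    rintro ⟨j, hj, rfl⟩
    exact hI.2 j i T hj hT hx
  refine ⟨σ, rfl, ?_, Iff.rfl, ?_, False.elim⟩
  · simp only [rootNode, modedRoot, List.map_cons, List.map_nil, Literal.subst,
      Q.inst_var_subst hσ hσ']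
  · rintro x ⟨i, hi, rfl⟩
    rw [hσ i hi]
    exact ht i hi

end ModedQuery

/-- The Herbrand universe is not empty. -/
theorem exists_mem_herbrandUniverse (a : L.Constants) (S : Set (Σ n, L.Functions n)) :
    ∃ t, t ∈ herbrandUniverse a S := by
  by_cases h : ∃ c : L.Constants, (⟨0, c⟩ : Σ n, L.Functions n) ∈ S
  · obtain ⟨c, hc⟩ := h
    exact ⟨Term.func (l := 0) c Fin.elim0, by simp, fun f hf => Or.inl (by simp_all)⟩
  · push Not at h
    exact ⟨Term.func (l := 0) a Fin.elim0, by simp, fun f hf => Or.inr ⟨h, by simp_all⟩⟩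

theorem ModedQuery.exists_forestRoots_derivation (P : Program L) (a : L.Constants)
    (Q : ModedQuery L) {I : Fin Q.arity → ℕ} (hI : Q.IsInputVars I)
    (D : InfDerivation P (Q.modedRoot I)) (hD : ¬ D.HasInfiniteInputChain) :
    ∃ N ∈ Q.forestRoots P a, Nonempty (InfDerivation P N) := by
  obtain ⟨t, ht, htS⟩ := exists_mem_herbrandUniverse a (P.funcs ∪ Q.funcs)
  -- Exactly the symbols allowed in the Herbrand universe, so that ground terms over `S` are
  -- admissible inputs.
  let S : Set (Σ n, L.Functions n) := {f | f ∈ P.funcs ∪ Q.funcs ∨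
    (∀ c : L.Constants, (⟨0, c⟩ : Σ n, L.Functions n) ∉ P.funcs ∪ Q.funcs) ∧ f = ⟨0, a⟩}
  have hPQ : P.funcs ∪ Q.funcs ⊆ S := fun f hf => Or.inl hf
  have hsig : (Q.modedRoot I).InSignature S (P.bodyPreds ∪ {⟨Q.arity, Q.pred⟩}) := fun s hs =>
    have h := Q.modedRoot_inSignature I s hs
    ⟨h.1.trans (Set.subset_union_right.trans hPQ), Or.inr h.2⟩
  obtain ⟨s, hg, hf, hs⟩ := D.exists_instantiate (Q.modedRoot_proper I) (fun h => h.elim) hD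
    (fun n => (D.step n).termFuncs_subset (Set.subset_union_left.trans hPQ)
      (D.inSignature (Set.subset_union_left.trans hPQ) Set.subset_union_left hsig n)) ht htS
  refine ⟨_, ⟨fun i => s (I i), fun i hi => ⟨hg _, fun f hf' => hf _ hf'⟩, rfl⟩, ?_⟩
  have hinst : (Q.inst fun i => Term.var (I i)).subst (mask (Q.modedRoot I).inputs s) =
      Q.inst fun i => s (I i) := by
    refine Q.inst_var_subst (fun i hi => mask_of_mem ⟨i, hi, rfl⟩) fun i T hT x hx =>
      mask_of_notMem ?_
    rintro ⟨j, hj, rfl⟩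
    exact hI.2 j i T hj hT hx
  -- A forest root records only the variables of its own query, fewer than the moded root whenever
  -- there are input modes.
  have hused : (Q.inst fun i => s (I i)).vars ∪ ∅ ⊆ (Q.modedRoot I).used := by
    rw [Set.union_empty, ← hinst]
    intro y hy
    obtain ⟨x, hx, hy⟩ := Atom.mem_vars_subst.1 hy
    by_cases hxi : x ∈ (Q.modedRoot I).inputs
    · rw [mask_of_mem hxi, hg] at hy
      exact hy.elim
    · rw [mask_of_notMem hxi] at hy
      obtain rfl : y = x := by simpa using hy
      exact Or.inl hx
  have hroot : (Q.modedRoot I).instantiate s ((Q.inst fun i => s (I i)).vars ∪ ∅) =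
      rootNode (Q.inst fun i => s (I i)) ∅ := by
    rw [← hinst]; rfl
  rw [← hroot]
  exact hs _ hused

end LP

theorem mainTheorem2 {L : FirstOrder.Language.{u, v}} (P : LP.Program L) (a : L.Constants)
    (Q : LP.ModedQuery L) (I : Fin Q.arity → ℕ) (hI : Q.IsInputVars I)
    (hQ : LP.NonFloundering P (Q.modedRoot I)) :
    LP.Terminates P a Q ↔
      ¬ ∃ D : LP.InfDerivation P (Q.modedRoot I), D.HasLoopForm ∧ ¬ D.HasInfiniteInputChain := by
  constructor
  · rintro hT ⟨D, -, hD⟩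
    obtain ⟨N, hN, ⟨D'⟩⟩ := Q.exists_forestRoots_derivation P a hI D hD
    exact (hT N hN).false D'
  · rintro hno N ⟨t, ht, rfl⟩
    refine ⟨fun D => hno ?_⟩
    obtain ⟨σ, hσ⟩ := Q.exists_lifts hI fun i hi => (ht i hi).1
    obtain ⟨D', hD'⟩ := D.exists_lift hσ (Q.modedRoot_proper I)
      (LP.rootNode_proper _ Set.finite_empty) hQ
    refine ⟨D', D'.hasLoopForm rfl (S := P.funcs ∪ Q.funcs)
      (R := P.bodyPreds ∪ {⟨Q.arity, Q.pred⟩}) Set.subset_union_left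
      (P.finite_funcs.union Q.finite_funcs) Set.subset_union_left
      (P.finite_bodyPreds.union (Set.finite_singleton _)) fun s hs => ?_, hD'⟩
    have h := Q.modedRoot_inSignature I s hs
    exact ⟨h.1.trans Set.subset_union_right, Or.inr h.2⟩
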